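/- **Setting.** Let $\mathcal P_d$ be the manifold of real symmetric positive definite $d\times d$ matrices with the affine-invariant metric $\langle U,V\rangle_P=\operatorname{tr}(P^{-1}UP^{-1}V)$ and distance $\delta(P,Q)=\|\log(P^{-1/2}QP^{-1/2})\|_F$. Its exponential and logarithm maps are $\mathrm{Exp}_P(U)=P^{1/2}\exp(P^{-1/2}UP^{-1/2})P^{1/2}$ and $\mathrm{Log}_P(Q)=P^{1/2}\log(P^{-1/2}QP^{-1/2})P^{1/2}$. Tangent vectors at $P$ are identified with $\mathbb R^{D}$, $D=d(d+1)/2$, by $U\mapsto \mathrm{vect}(P^{-1/2}UP^{-1/2})$, where $\mathrm{vect}$ lists the upper triangle with off-diagonal entries multiplied by $\sqrt2$ (coordinates in an orthonormal basis of $T_P\mathcal P_d$). For $\mu\in\mathbb R^D$ and $\Sigma\in\mathcal P_D$, the wrapped Gaussian $\mathrm{WG}(P,\mu,\Sigma)$ is the law of $\mathrm{Exp}_P(t)$ with $t\sim\mathcal N(\mu,\Sigma)$. Its density with respect to the Riemannian volume is $f_{P,\mu,\Sigma}(X)=g_{\mu,\Sigma}(\mathrm{Log}_P X)/|J_P(\mathrm{Log}_PX)|$,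 where $g_{\mu,\Sigma}$ is the density of $\mathcal N(\mu,\Sigma)$ and $J_P=\det(d\,\mathrm{Exp}_P)$. The Bayes classifier for classes with likelihoods $f_1,\dots,f_K$ assigns $Z$ to a class $k$ maximising $f_k(Z)$. Let $\alpha_1,\dots,\alpha_K$ be probability measures on $\mathcal P_d$ with total distribution $\alpha=\frac1K\sum_k\alpha_k$. Let $(X_i,Y_i)_{i\ge1}$ be i.i.d., with $Y_i$ uniform on $\{1,\dots,K\}$ and $X_i\sim\alpha_k$ given $Y_i=k$. **Classifiers.** Tangent Space LDA (resp. QDA) with $N\geq 1$ training points computes the Riemannian mean $\hat X_N=\operatorname{argmin}_P\sum_{i\le N}\delta(X_i,P)^2$, sets $x_i=\mathrm{Log}_{\hat X_N}(X_i)$ and $z=\mathrm{Log}_{\hat X_N}(Z)$ in the coordinates above, and assigns $Z$ to a class maximising the discriminant score $$z^\top\hat\Sigma^{-1}\hat\mu_k-\tfrac12\hat\mu_k^\top\hat\Sigma^{-1}\hat\mu_k+\log\hat\pi_k\qquad\Big(\text{resp. } -\tfrac12\log\det\hat\Sigma_k-\tfrac12(z-\hat\mu_k)^\top\hat\Sigma_k^{-1}(z-\hat\mu_k)+\log\hat\pi_k\Big).$$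 Here $N_k$ is the number of training points in class $k$, $\hat\pi_k=N_k/N$, $\hat\mu_k$ is the empirical mean of the $x_i$ in class $k$, $W_k=\sum_{i\le N:Y_i=k}(x_i-\hat\mu_k)(x_i-\hat\mu_k)^\top$, $\hat\Sigma=\frac1{N-K}\sum_kW_k$ and $\hat\Sigma_k=\frac1{N_k-1}W_k$. Scores $s_{N,k}$ are said to *converge to the Bayes classifier* with class likelihoods $f_k$ if for every $Z\in\mathcal P_d$: (i) $s_{N,j}(Z)-s_{N,k}(Z)\to\log f_j(Z)-\log f_k(Z)$ for all $j,k$; and (ii) for all large $N$, every class maximising $s_{N,\cdot}(Z)$ also maximises $f_\cdot(Z)$. **Proposition.** 1. Every nonempty finite sample in $\mathcal P_d$ has exactly one Riemannian mean. 2. Suppose each $\alpha_k$ has a finite second moment, i.e. $\int\delta(X,Q)^2\,d\alpha_k(X)<\infty$ for some $Q$. Then $\alpha$ has exactly one Fréchet mean $\bar X=\operatorname{argmin}_{Y}\int\delta(X,Y)^2\,d\alpha(X)$. Let $\mu_k$ and $\Sigma_k$ be the mean and covariance of $\mathrm{Log}_{\bar X}(X)$ for $X\sim\alpha_k$, and $\Sigma=\frac1K\sum_k\Sigma_k$.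 - If $\Sigma$ is positive definite, then almost surely Tangent Space LDA converges to the Bayes classifier with classes $\mathrm{WG}(\bar X,\mu_k,\Sigma)$. - If all $\Sigma_k$ are positive definite, then almost surely Tangent Space QDA converges to the Bayes classifier with classes $\mathrm{WG}(\bar X,\mu_k,\Sigma_k)$. 3. In particular, with no moment hypothesis: if $\alpha_k=\mathrm{WG}(\bar X,\mu_k,\Sigma)$ for all $k$ (resp. $\alpha_k=\mathrm{WG}(\bar X,\mu_k,\Sigma_k)$), with positive definite covariance parameters and with $\bar X$ a Fréchet mean of $\alpha$, then almost surely Tangent Space LDA (resp. QDA) converges to the Bayes classifier of the classes $\alpha_k$. -/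

import Mathlib

open MeasureTheory ProbabilityTheory Filter Topology Matrix
open scoped ENNReal

noncomputable section

namespace SPDLearning

/-! ### Symmetric positive definite matrices with the affine-invariant Riemannian metric -/

/-- The manifold of real symmetric positive definite `d × d` matrices. -/
abbrev SPD (d : ℕ) : Type := {X : Matrix (Fin d) (Fin d) ℝ // X.PosDef}

instance (d : ℕ) : MeasurableSpace (SPD d) := borel _

instance (d : ℕ) : BorelSpace (SPD d) := ⟨rfl⟩

instance (d : ℕ) : Nonempty (SPD d) := ⟨⟨1, Matrix.PosDef.one⟩⟩

variable {d : ℕ}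

/-- The symmetric square root `P^{1/2}` (spectral functional calculus). -/
def sqrtm (P : SPD d) : Matrix (Fin d) (Fin d) ℝ := cfc Real.sqrt P.1

/-- The inverse square root `P^{-1/2}`. -/
def invSqrtm (P : SPD d) : Matrix (Fin d) (Fin d) ℝ := (sqrtm P)⁻¹

/-- The matrix logarithm (spectral functional calculus). -/
def logm (A : Matrix (Fin d) (Fin d) ℝ) : Matrix (Fin d) (Fin d) ℝ := cfc Real.log A

/-- The Frobenius norm. -/
def frobNorm (A : Matrix (Fin d) (Fin d) ℝ) : ℝ := √(∑ i, ∑ j, A i j ^ 2)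

/-- The affine-invariant Riemannian distance
`δ(P,Q) = ‖log (P^{-1/2} Q P^{-1/2})‖_F`. -/
def airmDist (P Q : SPD d) : ℝ := frobNorm (logm (invSqrtm P * Q.1 * invSqrtm P))

/-- The Riemannian exponential map at `P`, for a tangent vector (symmetric matrix) `U`:
`Exp_P(U) = P^{1/2} exp(P^{-1/2} U P^{-1/2}) P^{1/2}`. -/
def riemExp (P : SPD d) (U : Matrix (Fin d) (Fin d) ℝ) : Matrix (Fin d) (Fin d) ℝ :=
  sqrtm P * NormedSpace.exp (invSqrtm P * U * invSqrtm P) * sqrtm P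

/-- The Riemannian logarithm at `P`:
`Log_P(Q) = P^{1/2} log(P^{-1/2} Q P^{-1/2}) P^{1/2}`. -/
def riemLog (P Q : SPD d) : Matrix (Fin d) (Fin d) ℝ :=
  sqrtm P * logm (invSqrtm P * Q.1 * invSqrtm P) * sqrtm P

/-! ### Coordinates on the tangent spaces -/

/-- Upper-triangular index pairs; there are `d(d+1)/2` of them. -/
abbrev UpperIdx (d : ℕ) : Type := {p : Fin d × Fin d // p.1 ≤ p.2}

/-- The coordinate space `ℝ^{d(d+1)/2}`. -/
abbrev Coord (d : ℕ) : Type := EuclideanSpace ℝ (UpperIdx d)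

/-- The isometric vectorisation of symmetric matrices: upper triangle, off-diagonal entries
multiplied by `√2`. -/
def vect (S : Matrix (Fin d) (Fin d) ℝ) : Coord d :=
  WithLp.toLp 2 fun p => if p.1.1 = p.1.2 then S p.1.1 p.1.2 else √2 * S p.1.1 p.1.2

/-- The inverse of `vect`: the symmetric matrix with given coordinates. -/
def unvect (t : Coord d) : Matrix (Fin d) (Fin d) ℝ :=
  Matrix.of fun i j =>
    if i = j then t ⟨(min i j, max i j), min_le_max⟩
    else t ⟨(min i j, max i j), min_le_max⟩ / √2

/-- Coordinates of a tangent vector at `P` in an orthonormal basis for the affine-invariant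
inner product `tr(P⁻¹ U P⁻¹ V)`: `U ↦ vect(P^{-1/2} U P^{-1/2})`. -/
def tangentCoord (P : SPD d) (U : Matrix (Fin d) (Fin d) ℝ) : Coord d :=
  vect (invSqrtm P * U * invSqrtm P)

/-- The tangent vector at `P` with coordinates `t`: the inverse of `tangentCoord P`. -/
def tangentVec (P : SPD d) (t : Coord d) : Matrix (Fin d) (Fin d) ℝ :=
  sqrtm P * unvect t * sqrtm P

/-- The coordinates of `Log_P(X)` (normal coordinates at `P`). -/
def logCoord (P X : SPD d) : Coord d := tangentCoord P (riemLog P X)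

theorem sqrtm_isHermitian (P : SPD d) : (sqrtm P).IsHermitian :=
  cfc_predicate (R := ℝ) (p := IsSelfAdjoint) Real.sqrt P.1

theorem invSqrtm_isHermitian (P : SPD d) : (invSqrtm P).IsHermitian :=
  (sqrtm_isHermitian P).inv

theorem unvect_isHermitian (t : Coord d) : (unvect t).IsHermitian := by
  ext i j
  simp only [unvect, conjTranspose_apply, of_apply, star_trivial, eq_comm (a := j) (b := i),
    min_comm j i, max_comm j i]

theorem sqrtm_isUnit (P : SPD d) : IsUnit (sqrtm P) := by
  unfold sqrtm
  have hfin : ContinuousOn Real.sqrt (spectrum ℝ P.1) := Real.continuous_sqrt.continuousOn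
  refine (isUnit_cfc_iff Real.sqrt P.1 hfin P.2.isHermitian).2 ?_
  intro x hx
  rw [P.2.isHermitian.spectrum_real_eq_range_eigenvalues] at hx
  obtain ⟨i, rfl⟩ := hx
  exact (Real.sqrt_pos.2 (P.2.eigenvalues_pos i)).ne'

theorem exp_posDef {A : Matrix (Fin d) (Fin d) ℝ} (hA : A.IsHermitian) :
    (NormedSpace.exp A).PosDef := by
  have hB : ((2⁻¹ : ℝ) • A).IsHermitian := by
    ext i j
    have := hA.apply i j
    simp only [star_trivial] at this
    simp only [conjTranspose_apply, star_trivial, Matrix.smul_apply, smul_eq_mul, this]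
  have h1 : A = (2⁻¹ : ℝ) • A + (2⁻¹ : ℝ) • A := by
    rw [← add_smul]; norm_num
  have h2 : NormedSpace.exp A =
      (NormedSpace.exp ((2⁻¹ : ℝ) • A))ᴴ * NormedSpace.exp ((2⁻¹ : ℝ) • A) := by
    rw [← Matrix.exp_conjTranspose, hB.eq, ← Matrix.exp_add_of_commute _ _ (Commute.refl _), ← h1]
  rw [h2]
  exact Matrix.PosDef.conjTranspose_mul_self _
    (Matrix.mulVec_injective_of_isUnit (Matrix.isUnit_exp _))

theorem riemExp_posDef (P : SPD d) (t : Coord d) : (riemExp P (tangentVec P t)).PosDef := by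
  have hc {A B : Matrix (Fin d) (Fin d) ℝ} (hA : A.IsHermitian) (hB : B.IsHermitian) :
      (A * B * A).IsHermitian := by
    have := isHermitian_mul_mul_conjTranspose A hB
    rwa [hA.eq] at this
  have h := (exp_posDef (hc (invSqrtm_isHermitian P)
    (hc (sqrtm_isHermitian P) (unvect_isHermitian t)))).mul_mul_conjTranspose_same
      (B := sqrtm P) (Matrix.vecMul_injective_of_isUnit (sqrtm_isUnit P))
  rw [(sqrtm_isHermitian P).eq] at h
  exact h

/-- The Riemannian exponential map at `P` read in the coordinates of the tangent space at `P`. -/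
def expCoord (P : SPD d) (t : Coord d) : SPD d :=
  ⟨riemExp P (tangentVec P t), riemExp_posDef P t⟩

/-! ### Wrapped Gaussian distributions -/

/-- The wrapped Gaussian `WG(P; μ, Σ)`: the law of `Exp_P(t)` with `t ∼ N(μ, Σ)`. -/
def wrappedGaussian (P : SPD d) (μ : Coord d) (S : Matrix (UpperIdx d) (UpperIdx d) ℝ) :
    Measure (SPD d) :=
  (multivariateGaussian μ S).map (expCoord P)

/-- The density of the multivariate Gaussian `N(μ, Σ)`. -/
def gaussianDensity {ι : Type*} [Fintype ι] [DecidableEq ι] (μ : EuclideanSpace ℝ ι)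
    (S : Matrix ι ι ℝ) (x : EuclideanSpace ℝ ι) : ℝ :=
  (√((2 * Real.pi) ^ Fintype.card ι * S.det))⁻¹ *
    Real.exp (-(1 / 2) * ((x - μ).ofLp ⬝ᵥ (S⁻¹ *ᵥ (x - μ).ofLp)))

/-- The Jacobian determinant `J_P = det(d Exp_P)` at the tangent vector with coordinates `t`.
The differential `T_P → T_Q`, `Q = Exp_P(t)`, is expressed in orthonormal bases of the two
tangent spaces. -/
def expJacobian (P : SPD d) (t : Coord d) : ℝ :=
  (fderiv ℝ (fun s : Coord d => tangentCoord (expCoord P t) (expCoord P s).1) t).det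

/-- The density of `WG(P; μ, Σ)` with respect to the Riemannian volume:
`g_{μ,Σ}(Log_P X) / |J_P(Log_P X)|`. -/
def wrappedGaussianDensity (P : SPD d) (μ : Coord d) (S : Matrix (UpperIdx d) (UpperIdx d) ℝ)
    (X : SPD d) : ℝ :=
  gaussianDensity μ S (logCoord P X) / |expJacobian P (logCoord P X)|

/-! ### Classifiers -/

/-- The classes that maximise a score. -/
def argmaxClasses {K : ℕ} (s : Fin K → ℝ) : Set (Fin K) := {k | ∀ j, s j ≤ s k}

/-- The Bayes classifier for classes with likelihoods `f k`: the classes that maximise the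
likelihood of `Z`. -/
def bayesClassifier {E : Type*} {K : ℕ} (f : Fin K → E → ℝ) (Z : E) : Set (Fin K) :=
  argmaxClasses fun k => f k Z

section Euclidean

variable {ι : Type*} [Fintype ι] [DecidableEq ι] {N K : ℕ}

/-- The number of training points in class `k`. -/
def classCount (y : Fin N → Fin K) (k : Fin K) : ℕ := (Finset.univ.filter fun i => y i = k).card

/-- The estimated prior `N_k / N`. -/
def classPrior (y : Fin N → Fin K) (k : Fin K) : ℝ := (classCount y k : ℝ) / N

/-- The empirical mean of class `k`. -/
def classMean (x : Fin N → EuclideanSpace ℝ ι) (y : Fin N → Fin K) (k : Fin K) :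
    EuclideanSpace ℝ ι :=
  (classCount y k : ℝ)⁻¹ • ∑ i ∈ Finset.univ.filter fun i => y i = k, x i

/-- The scatter matrix of class `k` around its empirical mean. -/
def classScatter (x : Fin N → EuclideanSpace ℝ ι) (y : Fin N → Fin K) (k : Fin K) :
    Matrix ι ι ℝ :=
  ∑ i ∈ Finset.univ.filter fun i => y i = k,
    vecMulVec (x i - classMean x y k).ofLp (x i - classMean x y k).ofLp

/-- The empirical covariance matrix of class `k` (normalised by `N_k - 1`). -/
def classCov (x : Fin N → EuclideanSpace ℝ ι) (y : Fin N → Fin K) (k : Fin K) :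
    Matrix ι ι ℝ :=
  ((classCount y k : ℝ) - 1)⁻¹ • classScatter x y k

/-- The pooled within-class covariance matrix (normalised by `N - K`). -/
def pooledCov (x : Fin N → EuclideanSpace ℝ ι) (y : Fin N → Fin K) : Matrix ι ι ℝ :=
  ((N : ℝ) - K)⁻¹ • ∑ k, classScatter x y k

/-- The linear discriminant function of class `k`. -/
def ldaScore (x : Fin N → EuclideanSpace ℝ ι) (y : Fin N → Fin K) (k : Fin K)
    (z : EuclideanSpace ℝ ι) : ℝ :=
  z.ofLp ⬝ᵥ ((pooledCov x y)⁻¹ *ᵥ (classMean x y k).ofLp)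
    - (1 / 2) * ((classMean x y k).ofLp ⬝ᵥ ((pooledCov x y)⁻¹ *ᵥ (classMean x y k).ofLp))
    + Real.log (classPrior y k)

/-- The quadratic discriminant function of class `k`. -/
def qdaScore (x : Fin N → EuclideanSpace ℝ ι) (y : Fin N → Fin K) (k : Fin K)
    (z : EuclideanSpace ℝ ι) : ℝ :=
  -(1 / 2) * Real.log (classCov x y k).det
    - (1 / 2) * ((z - classMean x y k).ofLp ⬝ᵥ
        ((classCov x y k)⁻¹ *ᵥ (z - classMean x y k).ofLp))
    + Real.log (classPrior y k)

end Euclidean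

/-- `P` is a Riemannian mean of the sample `x`: it minimises the sum of squared distances. -/
def IsRiemannianMean {N : ℕ} (x : Fin N → SPD d) (P : SPD d) : Prop :=
  ∀ Q, ∑ i, airmDist (x i) P ^ 2 ≤ ∑ i, airmDist (x i) Q ^ 2

/-- The Riemannian mean of a sample. -/
def riemannianMean {N : ℕ} (x : Fin N → SPD d) : SPD d := Classical.epsilon (IsRiemannianMean x)

/-- Discriminant function of Tangent Space LDA: map all matrices to the tangent space at the
Riemannian mean of the whole training set, then apply LDA there. -/
def tsLdaScore {N K : ℕ} (x : Fin N → SPD d) (y : Fin N → Fin K) (k : Fin K) (Z : SPD d) : ℝ :=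
  ldaScore (fun i => logCoord (riemannianMean x) (x i)) y k (logCoord (riemannianMean x) Z)

/-- Discriminant function of Tangent Space QDA. -/
def tsQdaScore {N K : ℕ} (x : Fin N → SPD d) (y : Fin N → Fin K) (k : Fin K) (Z : SPD d) : ℝ :=
  qdaScore (fun i => logCoord (riemannianMean x) (x i)) y k (logCoord (riemannianMean x) Z)

/-- A sequence of classifiers `Z ↦ argmax_k score N k Z` converges to the Bayes classifier with
class likelihoods `f k`: at every point `Z`, differences of scores converge to log-likelihood
ratios, and for all large `N` every class selected at `Z` is one selected by the Bayes
classifier. -/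
def ConvergesToBayes {E : Type*} {K : ℕ} (score : ℕ → Fin K → E → ℝ) (f : Fin K → E → ℝ) : Prop :=
  ∀ Z,
    (∀ j k, Tendsto (fun N => score N j Z - score N k Z) atTop
      (𝓝 (Real.log (f j Z) - Real.log (f k Z)))) ∧
    ∀ᶠ N in atTop, argmaxClasses (fun k => score N k Z) ⊆ bayesClassifier f Z

/-! ### Population quantities -/

/-- The total distribution `(1/K) ∑ k, α k`. -/
def totalDistribution {K : ℕ} (α : Fin K → Measure (SPD d)) : Measure (SPD d) :=
  (K : ℝ≥0∞)⁻¹ • ∑ k, α k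

/-- The law of a labelled data point: the label is uniform on the `K` classes and, given label
`k`, the point has law `α k`. -/
def labelledDistribution {K : ℕ} (α : Fin K → Measure (SPD d)) : Measure (SPD d × Fin K) :=
  (K : ℝ≥0∞)⁻¹ • ∑ k, (α k).map fun X => (X, k)

/-- Finite second moment. -/
def HasFiniteSecondMoment (ν : Measure (SPD d)) : Prop :=
  ∃ Q, Integrable (fun X => airmDist X Q ^ 2) ν

/-- `P` is a Fréchet mean of `ν`: it minimises `Q ↦ ∫ δ(X,Q)² dν(X)`. -/
def IsFrechetMean (ν : Measure (SPD d)) (P : SPD d) : Prop :=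
  (∀ Q, Integrable (fun X => airmDist X Q ^ 2) ν) ∧
    ∀ Q, ∫ X, airmDist X P ^ 2 ∂ν ≤ ∫ X, airmDist X Q ^ 2 ∂ν

/-- The mean of `Log_P(X)` for `X ∼ ν`. -/
def logMean (P : SPD d) (ν : Measure (SPD d)) : Coord d := ∫ X, logCoord P X ∂ν

/-- The covariance matrix of `Log_P(X)` for `X ∼ ν`. -/
def logCov (P : SPD d) (ν : Measure (SPD d)) : Matrix (UpperIdx d) (UpperIdx d) ℝ :=
  Matrix.of fun a b => cov[fun X => logCoord P X a, fun X => logCoord P X b; ν]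

/-- The pooled (within-class) covariance matrix `(1/K) ∑ k, Cov(Log_P(X)), X ∼ α k`. -/
def pooledLogCov {K : ℕ} (P : SPD d) (α : Fin K → Measure (SPD d)) :
    Matrix (UpperIdx d) (UpperIdx d) ℝ :=
  (K : ℝ)⁻¹ • ∑ k, logCov P (α k)

end SPDLearning

end

noncomputable section

namespace SPDLearning

variable {d : ℕ}

/-! ### Matrix exponential and logarithm on symmetric matrices -/

section Frobenius

/-! All the geometry rests on one inequality: for a fixed base point `R`, the map `logCoord R` does
not increase distances (`norm_logCoord_sub_le`), which expresses nonpositive curvature.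
Infinitesimally, it says that the differential of `exp` at a symmetric `A`, measured in the
affine-invariant metric at `exp A`, does not shorten vectors (`norm_le_expSpeed`). Differentiating
exp A = exp(A/2)² shows that this measured length does not increase when `A` is halved; iterating
and letting the base point tend to 0, where the differential is the identity, gives the bound.
Integrating it along geodesics gives the global statement.

Comparison with the tangent space then yields the triangle inequality, the semi-parallelogram law,
the law of cosines and, by a one-sided tangency argument, the first variation of the squared
distance. Coercivity gives existence of Fréchet means, the semi-parallelogram law gives uniqueness,
and the first variation shows that the logarithms at a Fréchet mean average to zero.

For consistency, summing the law of cosines over a sample bounds the distance from any `P` to the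
sample mean by twice the norm of the averaged logarithms at `P` (`airmDist_riemannianMean_le`). At
the population mean this average tends to zero by the strong law, so the sample mean converges
almost surely.

The tangent features depend on the moving sample mean, so the strong law does not apply to them
directly. Their moments are compared with those at the fixed limit: on a ball by uniform continuity,
outside it by quadratic growth and small averaged tails of the squared distance
(`tendsto_average_abs_sub`). Empirical means and covariances therefore converge, and the scores tend
to Gaussian log-likelihoods up to a term common to all classes. The Jacobian of the exponential map
is nonzero and also common to all classes, so it cancels in likelihood ratios. A strict likelihood
gap between two classes eventually persists in the scores, which settles the argmax statement, ties
included. In the wrapped Gaussian case the logarithm undoes the exponential, so the parameters are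
exactly the tangent moments. -/

theorem cfc_exp {S : Matrix (Fin d) (Fin d) ℝ} (hS : S.IsHermitian) :
    cfc Real.exp S = NormedSpace.exp S := by
  open scoped Matrix.Norms.L2Operator in exact CFC.real_exp_eq_normedSpace_exp hS

theorem smul_isHermitian (c : ℝ) {S : Matrix (Fin d) (Fin d) ℝ} (hS : S.IsHermitian) :
    (c • S).IsHermitian := by
  rw [Matrix.IsHermitian, conjTranspose_smul, hS.eq, star_trivial]

theorem exp_add_smul (a b : ℝ) (S : Matrix (Fin d) (Fin d) ℝ) :
    NormedSpace.exp (a • S) * NormedSpace.exp (b • S) = NormedSpace.exp ((a + b) • S) := by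
  rw [← Matrix.exp_add_of_commute _ _ (((Commute.refl S).smul_left a).smul_right b), add_smul]

theorem logm_exp {S : Matrix (Fin d) (Fin d) ℝ} (hS : S.IsHermitian) :
    logm (NormedSpace.exp S) = S :=
  by open scoped Matrix.Norms.L2Operator in exact CFC.log_exp S hS

theorem logm_isHermitian (A : Matrix (Fin d) (Fin d) ℝ) : (logm A).IsHermitian :=
  cfc_predicate (R := ℝ) (p := IsSelfAdjoint) Real.log A

theorem spectrum_pos {P : Matrix (Fin d) (Fin d) ℝ} (hP : P.PosDef) {x : ℝ}
    (hx : x ∈ spectrum ℝ P) : 0 < x := by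
  rw [hP.isHermitian.spectrum_real_eq_range_eigenvalues] at hx
  obtain ⟨i, rfl⟩ := hx
  exact hP.eigenvalues_pos i

theorem exp_logm {P : Matrix (Fin d) (Fin d) ℝ} (hP : P.PosDef) :
    NormedSpace.exp (logm P) = P := by
  have hsa : IsSelfAdjoint P := hP.isHermitian
  have hc : ContinuousOn Real.log (spectrum ℝ P) :=
    Real.continuousOn_log.mono fun x hx => (spectrum_pos hP hx).ne'
  rw [← cfc_exp (logm_isHermitian P), logm,
    ← cfc_comp' Real.exp Real.log P Real.continuous_exp.continuousOn hc]
  conv_rhs => rw [← cfc_id (R := ℝ) P]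
  exact cfc_congr fun x hx => Real.exp_log (spectrum_pos hP hx)

/-- Puts P^{1/2} among the exponentials of multiples of log P, so that identities between square
roots and their inverses become addition of exponents, and their continuity reduces to that of `exp`
and `logm`. -/
theorem sqrtm_eq (P : SPD d) : sqrtm P = NormedSpace.exp ((2⁻¹ : ℝ) • logm P.1) := by
  have hsa : IsSelfAdjoint P.1 := P.2.isHermitian
  have hc : ContinuousOn Real.log (spectrum ℝ P.1) :=
    Real.continuousOn_log.mono fun x hx => (spectrum_pos P.2 hx).ne'
  rw [← cfc_exp (smul_isHermitian _ (logm_isHermitian P.1)), logm,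
    ← cfc_const_mul (2⁻¹ : ℝ) Real.log P.1 hc,
    ← cfc_comp' Real.exp (fun x => 2⁻¹ * Real.log x) P.1
      Real.continuous_exp.continuousOn (continuousOn_const.mul hc)]
  refine cfc_congr fun x hx => ?_
  have hx := spectrum_pos P.2 hx
  rw [← Real.exp_log (Real.sqrt_pos.2 hx), Real.log_sqrt hx.le]
  ring_nf

-- Frobenius norm and orthonormal coordinates on symmetric matrices

attribute [local instance] Matrix.frobeniusNormedAddCommGroup Matrix.frobeniusNormedSpace
  Matrix.frobeniusNormedRing Matrix.frobeniusNormedAlgebra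

theorem frobNorm_eq_norm (A : Matrix (Fin d) (Fin d) ℝ) : frobNorm A = ‖A‖ := by
  rw [frobNorm, Matrix.frobenius_norm_def, Real.sqrt_eq_rpow]
  simp

theorem norm_sq_eq_sum (A : Matrix (Fin d) (Fin d) ℝ) : ‖A‖ ^ 2 = ∑ i, ∑ j, A i j ^ 2 := by
  rw [← frobNorm_eq_norm, frobNorm, Real.sq_sqrt]
  exact Finset.sum_nonneg fun i _ => Finset.sum_nonneg fun j _ => sq_nonneg _

theorem norm_sq_eq_trace (A : Matrix (Fin d) (Fin d) ℝ) : ‖A‖ ^ 2 = (Aᵀ * A).trace := by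
  rw [norm_sq_eq_sum, Matrix.trace, Finset.sum_comm]
  simp [Matrix.mul_apply, sq]

theorem vect_unvect (t : Coord d) : vect (unvect t) = t := by
  ext ⟨⟨i, j⟩, hij⟩
  simp only at hij
  by_cases h : i = j
  · subst h; simp [vect, unvect]
  · simp only [vect, unvect, Matrix.of_apply, if_neg h, min_eq_left hij, max_eq_right hij]
    field_simp

theorem unvect_vect {S : Matrix (Fin d) (Fin d) ℝ} (hS : S.IsHermitian) :
    unvect (vect S) = S := by
  ext i j
  have hs : S j i = S i j := by simpa using hS.apply i j
  by_cases h : i = j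
  · subst h; simp [vect, unvect]
  · rcases le_total i j with hij | hij
    · simp only [vect, unvect, Matrix.of_apply, if_neg h, min_eq_left hij, max_eq_right hij]
      field_simp
    · simp only [vect, unvect, Matrix.of_apply, if_neg h, if_neg (Ne.symm h), min_eq_right hij,
        max_eq_left hij, hs]
      field_simp

/-- `vect` as a linear map. -/
def vectL : Matrix (Fin d) (Fin d) ℝ →L[ℝ] Coord d :=
  LinearMap.toContinuousLinearMap
    { toFun := vect
      map_add' := fun A B => by
        ext p; by_cases h : p.1.1 = p.1.2 <;> simp [vect, h, mul_add]
      map_smul' := fun c A => by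
        ext p; by_cases h : p.1.1 = p.1.2 <;> simp [vect, h]; ring }

/-- `unvect` as a linear map. -/
def unvectL : Coord d →L[ℝ] Matrix (Fin d) (Fin d) ℝ :=
  LinearMap.toContinuousLinearMap
    { toFun := unvect
      map_add' := fun A B => by
        ext i j; by_cases h : i = j <;> simp [unvect, h, add_div]
      map_smul' := fun c A => by
        ext i j; by_cases h : i = j <;> simp [unvect, h, mul_div_assoc] }

@[simp] theorem vectL_apply (A : Matrix (Fin d) (Fin d) ℝ) : vectL A = vect A := rfl

@[simp] theorem unvectL_apply (t : Coord d) : unvectL t = unvect t := rfl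

/-- The factor √2 makes each strictly upper entry count twice in the squared norm, which accounts
for its mirror image below the diagonal. -/
theorem norm_vect {S : Matrix (Fin d) (Fin d) ℝ} (hS : S.IsHermitian) : ‖vect S‖ = ‖S‖ := by
  have hs : ∀ i j, S j i = S i j := fun i j => by simpa using hS.apply i j
  rw [← sq_eq_sq₀ (norm_nonneg _) (norm_nonneg _), norm_sq_eq_sum, EuclideanSpace.norm_sq_eq,
    ← Finset.sum_product']
  have h1 : ∀ p : UpperIdx d, ‖vect S p‖ ^ 2 =
      (if p.1.1 = p.1.2 then 1 else 2) * S p.1.1 p.1.2 ^ 2 := by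
    intro p
    by_cases h : p.1.1 = p.1.2 <;> simp [vect, h, mul_pow]
  simp_rw [h1]
  rw [← Finset.sum_subtype (Finset.univ.filter fun p : Fin d × Fin d => p.1 ≤ p.2) (by simp)
    (fun p : Fin d × Fin d => (if p.1 = p.2 then (1 : ℝ) else 2) * S p.1 p.2 ^ 2),
    Finset.sum_filter]
  have h2 : ∑ p : Fin d × Fin d, S p.1 p.2 ^ 2 =
      ∑ p : Fin d × Fin d, (if p.1 ≤ p.2 then S p.1 p.2 ^ 2 else 0) +
      ∑ p : Fin d × Fin d, (if p.1 < p.2 then S p.1 p.2 ^ 2 else 0) := by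
    have : ∑ p : Fin d × Fin d, (if p.1 < p.2 then S p.1 p.2 ^ 2 else 0) =
        ∑ p : Fin d × Fin d, (if p.2 < p.1 then S p.1 p.2 ^ 2 else 0) := by
      rw [← (Equiv.prodComm (Fin d) (Fin d)).sum_comp]
      simp [hs]
    rw [this, ← Finset.sum_add_distrib]
    refine Finset.sum_congr rfl fun p _ => ?_
    rcases le_or_gt p.1 p.2 with h | h
    · simp [h, not_lt.2 h]
    · simp [h, not_le.2 h]
  rw [Finset.univ_product_univ, h2, ← Finset.sum_add_distrib]
  refine Finset.sum_congr rfl fun p _ => ?_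
  rcases lt_trichotomy p.1 p.2 with h | h | h
  · simp [h.le, h, h.ne]; ring
  · simp [h]
  · simp [not_le.2 h, not_lt.2 h.le]

theorem vect_injOn {S T : Matrix (Fin d) (Fin d) ℝ} (hS : S.IsHermitian) (hT : T.IsHermitian)
    (h : vect S = vect T) : S = T := by
  rw [← unvect_vect hS, h, unvect_vect hT]

theorem norm_unvect (t : Coord d) : ‖unvect t‖ = ‖t‖ := by
  rw [← norm_vect (unvect_isHermitian t), vect_unvect]

theorem norm_orthogonal_conj {U : Matrix (Fin d) (Fin d) ℝ} (hU : Uᵀ * U = 1)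
    (C : Matrix (Fin d) (Fin d) ℝ) : ‖U * C * Uᵀ‖ = ‖C‖ := by
  rw [← sq_eq_sq₀ (norm_nonneg _) (norm_nonneg _), norm_sq_eq_trace, norm_sq_eq_trace]
  simp only [Matrix.transpose_mul, Matrix.transpose_transpose]
  rw [show U * (Cᵀ * Uᵀ) * (U * C * Uᵀ) = U * (Cᵀ * (Uᵀ * U) * C * Uᵀ) by
    simp only [Matrix.mul_assoc], hU, Matrix.trace_mul_comm, Matrix.mul_one, Matrix.mul_assoc, hU,
    Matrix.mul_one]

theorem invSqrtm_eq (P : SPD d) : invSqrtm P = NormedSpace.exp ((-2⁻¹ : ℝ) • logm P.1) := by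
  refine Matrix.inv_eq_left_inv ?_
  rw [sqrtm_eq, exp_add_smul]
  simp

theorem sqrtm_mul_sqrtm (P : SPD d) : sqrtm P * sqrtm P = P.1 := by
  rw [sqrtm_eq, exp_add_smul, show (2⁻¹ : ℝ) + 2⁻¹ = 1 by norm_num, one_smul, exp_logm P.2]

theorem sqrtm_mul_invSqrtm (P : SPD d) : sqrtm P * invSqrtm P = 1 := by
  rw [sqrtm_eq, invSqrtm_eq, exp_add_smul]; simp

theorem invSqrtm_mul_sqrtm (P : SPD d) : invSqrtm P * sqrtm P = 1 := by
  rw [sqrtm_eq, invSqrtm_eq, exp_add_smul]; simp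

theorem transpose_eq_of_isHermitian {S : Matrix (Fin d) (Fin d) ℝ} (hS : S.IsHermitian) :
    Sᵀ = S := by
  have := hS.eq
  rwa [Matrix.conjTranspose_eq_transpose_of_trivial] at this

theorem sqrtm_transpose (P : SPD d) : (sqrtm P)ᵀ = sqrtm P :=
  transpose_eq_of_isHermitian (sqrtm_isHermitian P)

theorem invSqrtm_transpose (P : SPD d) : (invSqrtm P)ᵀ = invSqrtm P :=
  transpose_eq_of_isHermitian (invSqrtm_isHermitian P)

/-! ### Differential of the matrix exponential -/

theorem contDiff_matrixExp {n : WithTop ℕ∞} :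
    ContDiff ℝ n (NormedSpace.exp : Matrix (Fin d) (Fin d) ℝ → Matrix (Fin d) (Fin d) ℝ) :=
  contDiff_iff_contDiffAt.2 fun x => (NormedSpace.exp_analytic (𝕂 := ℝ) x).contDiffAt

theorem hasFDerivAt_matrixExp (A : Matrix (Fin d) (Fin d) ℝ) :
    HasFDerivAt (NormedSpace.exp : Matrix (Fin d) (Fin d) ℝ → Matrix (Fin d) (Fin d) ℝ)
      (fderiv ℝ NormedSpace.exp A) A :=
  ((contDiff_matrixExp (n := 1)).differentiable one_ne_zero A).hasFDerivAt

/-- The product rule applied to exp B = exp(B/2) · exp(B/2). This recursion replaces an integral or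
divided-difference formula for the differential. -/
theorem fderiv_matrixExp_halving (A H : Matrix (Fin d) (Fin d) ℝ) :
    fderiv ℝ NormedSpace.exp A H = (2⁻¹ : ℝ) •
      (NormedSpace.exp ((2⁻¹ : ℝ) • A) * fderiv ℝ NormedSpace.exp ((2⁻¹ : ℝ) • A) H +
        fderiv ℝ NormedSpace.exp ((2⁻¹ : ℝ) • A) H * NormedSpace.exp ((2⁻¹ : ℝ) • A)) := by
  have h1 : HasFDerivAt
      (fun B : Matrix (Fin d) (Fin d) ℝ => NormedSpace.exp ((2⁻¹ : ℝ) • B)) _ A :=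
    (hasFDerivAt_matrixExp ((2⁻¹ : ℝ) • A)).comp A ((hasFDerivAt_id A).const_smul (2⁻¹ : ℝ))
  have h2 := h1.mul' h1
  have h3 : (fun B : Matrix (Fin d) (Fin d) ℝ =>
      NormedSpace.exp ((2⁻¹ : ℝ) • B) * NormedSpace.exp ((2⁻¹ : ℝ) • B)) = NormedSpace.exp := by
    funext B
    rw [exp_add_smul, show (2⁻¹ : ℝ) + 2⁻¹ = 1 by norm_num, one_smul]
  have h4 : fderiv ℝ (fun B : Matrix (Fin d) (Fin d) ℝ =>
      NormedSpace.exp ((2⁻¹ : ℝ) • B) * NormedSpace.exp ((2⁻¹ : ℝ) • B)) A = _ := h2.fderiv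
  rw [h3] at h4
  rw [h4]
  change NormedSpace.exp ((2⁻¹ : ℝ) • A) * fderiv ℝ NormedSpace.exp ((2⁻¹ : ℝ) • A)
      ((2⁻¹ : ℝ) • H) + fderiv ℝ NormedSpace.exp ((2⁻¹ : ℝ) • A) ((2⁻¹ : ℝ) • H) *
      NormedSpace.exp ((2⁻¹ : ℝ) • A) = _
  rw [map_smul, Matrix.mul_smul, Matrix.smul_mul, smul_add]

/-- With A = R N R' and B = R' N R, the conjugating factors cancel under the trace, so tr(AᵀB) =
‖N‖². Entrywise, ab ≤ ((a + b)/2)² bounds tr(AᵀB) by the squared norm of the average of A and B. -/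
theorem norm_le_norm_conj_add {N R R' : Matrix (Fin d) (Fin d) ℝ} (hR : Rᵀ = R)
    (hR' : R'ᵀ = R') (h : R' * R = 1) : ‖N‖ ≤ ‖(2⁻¹ : ℝ) • (R * N * R' + R' * N * R)‖ := by
  have key : ∀ A B : Matrix (Fin d) (Fin d) ℝ,
      (Aᵀ * B).trace ≤ ‖(2⁻¹ : ℝ) • (A + B)‖ ^ 2 := by
    intro A B
    rw [norm_sq_eq_sum, Matrix.trace, Finset.sum_comm]
    simp only [Matrix.diag_apply, Matrix.mul_apply, Matrix.transpose_apply, Matrix.smul_apply,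
      Matrix.add_apply, smul_eq_mul]
    refine Finset.sum_le_sum fun i _ => Finset.sum_le_sum fun j _ => ?_
    nlinarith [sq_nonneg (A j i - B j i)]
  refine le_of_sq_le_sq ?_ (norm_nonneg _)
  refine le_trans (le_of_eq ?_) (key _ _)
  have h' : R * R' = 1 := mul_eq_one_comm.1 h
  rw [norm_sq_eq_trace]
  simp only [Matrix.transpose_mul, hR, hR']
  have e : R' * (Nᵀ * R) * (R' * N * R) = R' * (Nᵀ * (R * R') * N * R) := by
    simp only [Matrix.mul_assoc]
  rw [e, h', Matrix.trace_mul_comm R', Matrix.mul_one, Matrix.mul_assoc (Nᵀ * N), h',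
    Matrix.mul_one]

/-- The size of the differential of the matrix exponential at `A` in the direction `H`, measured
in the affine-invariant metric at `exp A`. -/
def expSpeed (A H : Matrix (Fin d) (Fin d) ℝ) : ℝ :=
  ‖NormedSpace.exp ((-2⁻¹ : ℝ) • A) * fderiv ℝ NormedSpace.exp A H *
    NormedSpace.exp ((-2⁻¹ : ℝ) • A)‖

theorem exp_smul_transpose {A : Matrix (Fin d) (Fin d) ℝ} (hA : A.IsHermitian) (c : ℝ) :
    (NormedSpace.exp (c • A))ᵀ = NormedSpace.exp (c • A) := by
  rw [← Matrix.exp_transpose, transpose_eq_of_isHermitian (smul_isHermitian c hA)]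

theorem expSpeed_half_le {A : Matrix (Fin d) (Fin d) ℝ} (hA : A.IsHermitian)
    (H : Matrix (Fin d) (Fin d) ℝ) : expSpeed ((2⁻¹ : ℝ) • A) H ≤ expSpeed A H := by
  unfold expSpeed
  rw [fderiv_matrixExp_halving A H]
  set D := fderiv ℝ NormedSpace.exp ((2⁻¹ : ℝ) • A) H
  -- With D the differential at A/2, take N = exp(-A/4) D exp(-A/4) and R = exp(A/4). The two
  -- conjugates are D exp(-A/2) and exp(-A/2) D, the terms produced by the halving identity.
  refine (norm_le_norm_conj_add (R := NormedSpace.exp ((4⁻¹ : ℝ) • A))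
    (R' := NormedSpace.exp ((-4⁻¹ : ℝ) • A)) (exp_smul_transpose hA _) (exp_smul_transpose hA _)
    (by rw [exp_add_smul]; simp)).trans (le_of_eq ?_)
  congr 1
  simp only [smul_smul, Matrix.mul_smul, Matrix.smul_mul, Matrix.mul_add, Matrix.add_mul]
  have e : ∀ a b c e : ℝ,
      NormedSpace.exp (a • A) * (NormedSpace.exp (b • A) * D * NormedSpace.exp (c • A)) *
        NormedSpace.exp (e • A) = NormedSpace.exp ((a + b) • A) * D *
          NormedSpace.exp ((c + e) • A) := by
    intro a b c e
    rw [← exp_add_smul, ← exp_add_smul]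
    simp only [Matrix.mul_assoc]
  have e1 : ∀ a b c : ℝ,
      NormedSpace.exp (a • A) * (NormedSpace.exp (b • A) * D) * NormedSpace.exp (c • A) =
        NormedSpace.exp ((a + b) • A) * D * NormedSpace.exp (c • A) := by
    intro a b c
    rw [← exp_add_smul]
    simp only [Matrix.mul_assoc]
  have e2 : ∀ a b c : ℝ,
      NormedSpace.exp (a • A) * (D * NormedSpace.exp (b • A)) * NormedSpace.exp (c • A) =
        NormedSpace.exp (a • A) * D * NormedSpace.exp ((b + c) • A) := by
    intro a b c
    rw [← exp_add_smul]
    simp only [Matrix.mul_assoc]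
  rw [e, e, e1, e2]
  norm_num

/-- Halving `A` repeatedly never increases the speed, and by continuity the speeds tend to the one
at 0, which is ‖H‖. -/
theorem norm_le_expSpeed {A : Matrix (Fin d) (Fin d) ℝ} (hA : A.IsHermitian)
    (H : Matrix (Fin d) (Fin d) ℝ) : ‖H‖ ≤ expSpeed A H := by
  have h1 : ∀ n : ℕ, expSpeed (((2⁻¹ : ℝ) ^ n) • A) H ≤ expSpeed A H := by
    intro n
    induction n with
    | zero => simp
    | succ n ih =>
      refine le_trans ?_ ih
      rw [pow_succ', mul_smul]
      exact expSpeed_half_le (smul_isHermitian _ hA) H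
  have hc : Continuous fun B : Matrix (Fin d) (Fin d) ℝ => expSpeed B H := by
    have h2 : Continuous fun B : Matrix (Fin d) (Fin d) ℝ => fderiv ℝ NormedSpace.exp B H :=
      ((contDiff_matrixExp (n := 1)).continuous_fderiv one_ne_zero).clm_apply continuous_const
    have h3 : Continuous fun B : Matrix (Fin d) (Fin d) ℝ =>
        NormedSpace.exp ((-2⁻¹ : ℝ) • B) :=
      (contDiff_matrixExp (n := 1)).continuous.comp (continuous_const_smul _)
    exact ((h3.mul h2).mul h3).norm
  have ht : Tendsto (fun n : ℕ => ((2⁻¹ : ℝ) ^ n) • A) atTop (𝓝 0) := by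
    have := (tendsto_pow_atTop_nhds_zero_of_lt_one (r := (2⁻¹ : ℝ)) (by norm_num)
      (by norm_num)).smul_const A
    rwa [zero_smul] at this
  have h0 : expSpeed 0 H = ‖H‖ := by
    unfold expSpeed
    have hz : HasFDerivAt (NormedSpace.exp : Matrix (Fin d) (Fin d) ℝ → _)
        (1 : Matrix (Fin d) (Fin d) ℝ →L[ℝ] Matrix (Fin d) (Fin d) ℝ) 0 := hasFDerivAt_exp_zero
    rw [hz.fderiv]
    simp
  have := (hc.tendsto 0).comp ht
  rw [h0] at this
  exact le_of_tendsto this (Eventually.of_forall h1)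

/-! ### Exponential and logarithm as maps of the coordinate space -/

/-- The matrix exponential in coordinates. -/
def expL (t : Coord d) : Coord d := vect (NormedSpace.exp (unvect t))

/-- The matrix logarithm in coordinates. -/
def logL (t : Coord d) : Coord d := vect (logm (unvect t))

theorem unvect_expL (t : Coord d) : unvect (expL t) = NormedSpace.exp (unvect t) :=
  unvect_vect (exp_posDef (unvect_isHermitian t)).isHermitian

theorem logL_expL (t : Coord d) : logL (expL t) = t := by
  rw [logL, unvect_expL, logm_exp (unvect_isHermitian t), vect_unvect]

theorem expL_vect_logm {P : Matrix (Fin d) (Fin d) ℝ} (hP : P.PosDef) :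
    expL (vect (logm P)) = vect P := by
  rw [expL, unvect_vect (logm_isHermitian P), exp_logm hP]

theorem logL_vect {P : Matrix (Fin d) (Fin d) ℝ} (hP : P.IsHermitian) :
    logL (vect P) = vect (logm P) := by
  rw [logL, unvect_vect hP]

theorem contDiff_expL {n : WithTop ℕ∞} : ContDiff ℝ n (expL : Coord d → Coord d) :=
  (vectL.contDiff.comp contDiff_matrixExp).comp unvectL.contDiff

theorem hasFDerivAt_expL (t : Coord d) : HasFDerivAt expL (fderiv ℝ expL t) t :=
  ((contDiff_expL (n := 1)).differentiable one_ne_zero t).hasFDerivAt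

theorem unvect_fderiv_expL (t h : Coord d) :
    unvect (fderiv ℝ expL t h) = fderiv ℝ NormedSpace.exp (unvect t) (unvect h) := by
  have h1 : HasFDerivAt (fun s : Coord d => unvectL (expL s))
      (unvectL.comp (fderiv ℝ expL t)) t :=
    unvectL.hasFDerivAt.comp t (hasFDerivAt_expL t)
  have h2 : HasFDerivAt (fun s : Coord d => NormedSpace.exp (unvectL s))
      ((fderiv ℝ NormedSpace.exp (unvectL t)).comp unvectL) t :=
    (hasFDerivAt_matrixExp (unvectL t)).comp t unvectL.hasFDerivAt
  have h3 : (fun s : Coord d => unvectL (expL s)) = fun s => NormedSpace.exp (unvectL s) :=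
    funext unvect_expL
  rw [h3] at h1
  exact congrArg (fun L : Coord d →L[ℝ] Matrix (Fin d) (Fin d) ℝ => L h) (h1.unique h2)

theorem norm_le_of_fderiv_expL (t h : Coord d) :
    ‖h‖ ≤ ‖NormedSpace.exp ((-2⁻¹ : ℝ) • unvect t) * unvect (fderiv ℝ expL t h) *
      NormedSpace.exp ((-2⁻¹ : ℝ) • unvect t)‖ := by
  rw [unvect_fderiv_expL, ← norm_unvect h]
  exact norm_le_expSpeed (unvect_isHermitian t) _

/-- The lower bound on the speed excludes a kernel. In finite dimension the differential is then
invertible, so the inverse function theorem applies at every point. -/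
theorem fderiv_expL_injective (t : Coord d) : Function.Injective (fderiv ℝ expL t) := by
  refine (injective_iff_map_eq_zero _).2 fun h hh => ?_
  have := norm_le_of_fderiv_expL t h
  have h0 : unvect (0 : Coord d) = 0 := unvectL.map_zero
  rw [hh, h0, Matrix.mul_zero, Matrix.zero_mul, norm_zero] at this
  exact norm_le_zero_iff.1 this

/-- The differential of `expL` as a linear equivalence. -/
def expLEquiv (t : Coord d) : Coord d ≃L[ℝ] Coord d :=
  (LinearEquiv.ofInjectiveEndo (fderiv ℝ expL t : Coord d →ₗ[ℝ] Coord d)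
    (fderiv_expL_injective t)).toContinuousLinearEquiv

theorem hasStrictFDerivAt_expL (t : Coord d) :
    HasStrictFDerivAt expL (expLEquiv t : Coord d →L[ℝ] Coord d) t :=
  (contDiff_expL (n := 1)).hasStrictFDerivAt one_ne_zero

theorem map_expL_nhds (t : Coord d) : map expL (𝓝 t) = 𝓝 (expL t) :=
  (hasStrictFDerivAt_expL t).map_nhds_eq_of_equiv

/-- `expL` carries neighbourhoods of t onto neighbourhoods of its image, and `logL` is a global left
inverse, so the claim pulls back to continuity of the identity. -/
theorem continuousAt_logL (t : Coord d) : ContinuousAt logL (expL t) := by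
  rw [ContinuousAt, logL_expL, ← map_expL_nhds, tendsto_map'_iff]
  exact tendsto_id.congr fun s => (logL_expL s).symm

theorem hasFDerivAt_logL (t : Coord d) :
    HasFDerivAt logL ((expLEquiv t).symm : Coord d →L[ℝ] Coord d) (expL t) := by
  refine HasFDerivAt.of_local_left_inverse (f := expL) (continuousAt_logL t) ?_ ?_
  · rw [logL_expL]
    exact (hasStrictFDerivAt_expL t).hasFDerivAt
  · rw [← map_expL_nhds, eventually_map]
    exact Eventually.of_forall fun s => by rw [logL_expL]

/-- Dual form of the speed bound: since `exp` does not shorten tangent vectors, the logarithm of a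
moving positive definite matrix moves at most as fast as the matrix does in the affine-invariant
metric. -/
theorem exists_hasDerivAt_vect_logm {γ : ℝ → Matrix (Fin d) (Fin d) ℝ}
    {γ' : Matrix (Fin d) (Fin d) ℝ} {t : ℝ} (hγ : HasDerivAt γ γ' t) (hP : ∀ s, (γ s).PosDef) :
    ∃ l : Coord d, HasDerivAt (fun s => vect (logm (γ s))) l t ∧
      ‖l‖ ≤ ‖invSqrtm ⟨γ t, hP t⟩ * γ' * invSqrtm ⟨γ t, hP t⟩‖ := by
  have h1 : HasDerivAt (fun s => vectL (γ s)) (vectL γ') t :=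
    vectL.hasFDerivAt.comp_hasDerivAt t hγ
  have h2 := hasFDerivAt_logL (vect (logm (γ t)))
  rw [expL_vect_logm (hP t)] at h2
  have h3 := h2.comp_hasDerivAt t h1
  have h4 : logL ∘ (fun s => vectL (γ s)) = fun s => vect (logm (γ s)) :=
    funext fun s => logL_vect (hP s).isHermitian
  rw [h4] at h3
  refine ⟨_, h3, ?_⟩
  set l := ((expLEquiv (vect (logm (γ t)))).symm : Coord d →L[ℝ] Coord d) (vectL γ')
  have h5 : fderiv ℝ expL (vect (logm (γ t))) l = vectL γ' :=
    (expLEquiv (vect (logm (γ t)))).apply_symm_apply (vectL γ')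
  -- Needed because coordinates recover a matrix only if it is symmetric; the velocity inherits
  -- symmetry from the curve.
  have h6 : γ'.IsHermitian := by
    have : HasDerivAt (fun s => (γ s)ᵀ) γ'ᵀ t :=
      ((Matrix.transposeLinearEquiv (Fin d) (Fin d) ℝ ℝ).toLinearMap.toContinuousLinearMap
        ).hasFDerivAt.comp_hasDerivAt t hγ
    have e : (fun s => (γ s)ᵀ) = γ :=
      funext fun s => transpose_eq_of_isHermitian (hP s).isHermitian
    rw [e] at this
    rw [Matrix.IsHermitian, Matrix.conjTranspose_eq_transpose_of_trivial]
    exact this.unique hγ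
  have h7 := norm_le_of_fderiv_expL (vect (logm (γ t))) l
  rwa [h5, vectL_apply, unvect_vect h6, unvect_vect (logm_isHermitian _),
    ← invSqrtm_eq ⟨γ t, hP t⟩] at h7

/-! ### Exponential metric increasing property -/

theorem congr_posDef {G S : Matrix (Fin d) (Fin d) ℝ} (hG : IsUnit G) (hS : S.PosDef) :
    (G * S * Gᵀ).PosDef := by
  have := hS.mul_mul_conjTranspose_same (B := G) (Matrix.vecMul_injective_of_isUnit hG)
  rwa [Matrix.conjTranspose_eq_transpose_of_trivial] at this

/-- Any frame G with P = G Gᵀ differs from P^{1/2} by an orthogonal factor, so norms computed in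
different frames at P agree. -/
theorem invSqrtm_mul_orthogonal {P : SPD d} {G : Matrix (Fin d) (Fin d) ℝ} (h : P.1 = G * Gᵀ) :
    (invSqrtm P * G) * (invSqrtm P * G)ᵀ = 1 := by
  rw [Matrix.transpose_mul, invSqrtm_transpose,
    show invSqrtm P * G * (Gᵀ * invSqrtm P) = invSqrtm P * (G * Gᵀ) * invSqrtm P by
      simp only [Matrix.mul_assoc], ← h, ← sqrtm_mul_sqrtm, ← Matrix.mul_assoc,
    invSqrtm_mul_sqrtm, Matrix.one_mul, sqrtm_mul_invSqrtm]

theorem exp_half_mul_exp_half (C : Matrix (Fin d) (Fin d) ℝ) :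
    NormedSpace.exp ((2⁻¹ : ℝ) • C) * NormedSpace.exp ((2⁻¹ : ℝ) • C) = NormedSpace.exp C := by
  rw [exp_add_smul, show (2⁻¹ : ℝ) + 2⁻¹ = 1 by norm_num, one_smul]

/-- The exponential metric increasing property. -/
theorem norm_vect_logm_sub_le {G C : Matrix (Fin d) (Fin d) ℝ} (hG : IsUnit G)
    (hC : C.IsHermitian) :
    ‖vect (logm (G * NormedSpace.exp C * Gᵀ)) - vect (logm (G * Gᵀ))‖ ≤ ‖C‖ := by
  have hP : ∀ s : ℝ, (G * NormedSpace.exp (s • C) * Gᵀ).PosDef := fun s =>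
    congr_posDef hG (exp_posDef (smul_isHermitian s hC))
  have hd : ∀ t : ℝ, HasDerivAt (fun s : ℝ => G * NormedSpace.exp (s • C) * Gᵀ)
      (G * (NormedSpace.exp (t • C) * C) * Gᵀ) t := fun t =>
    ((hasDerivAt_exp_smul_const C t).const_mul G).mul_const Gᵀ
  choose l hl hl' using fun t => exists_hasDerivAt_vect_logm (hd t) hP
  have hb : ∀ t, ‖l t‖ ≤ ‖C‖ := by
    intro t
    refine (hl' t).trans (le_of_eq ?_)
    set P : SPD d := ⟨G * NormedSpace.exp (t • C) * Gᵀ, hP t⟩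
    -- F is the square root of exp(tC), so G F is a frame at the point reached at time t. In it the
    -- velocity is C itself, hence the curve has constant speed ‖C‖.
    set F := NormedSpace.exp ((2⁻¹ : ℝ) • t • C) with hF
    have hFt : Fᵀ = F := exp_smul_transpose (smul_isHermitian t hC) _
    have hFF : F * F = NormedSpace.exp (t • C) := exp_half_mul_exp_half _
    have hFC : F * C = C * F :=
      (((Commute.refl C).smul_left t).smul_left (2⁻¹ : ℝ)).exp_left.eq
    have hU := invSqrtm_mul_orthogonal (P := P) (G := G * F) (by
      rw [Matrix.transpose_mul, hFt, show G * F * (F * Gᵀ) = G * (F * F) * Gᵀ by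
        simp only [Matrix.mul_assoc], hFF])
    rw [← norm_orthogonal_conj (mul_eq_one_comm.1 hU) C]
    congr 1
    rw [← hFF, Matrix.mul_assoc F F C, hFC]
    simp only [Matrix.transpose_mul, hFt, invSqrtm_transpose, Matrix.mul_assoc]
  have := norm_image_sub_le_of_norm_deriv_le_segment_01'
    (fun t _ => (hl t).hasDerivWithinAt) (fun t _ => hb t)
  simpa using this

/-! ### Normal coordinates, geodesics and nonpositive curvature -/

theorem isUnit_invSqrtm (P : SPD d) : IsUnit (invSqrtm P) :=
  IsUnit.of_mul_eq_one _ (invSqrtm_mul_sqrtm P)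

theorem whitened_posDef (P X : SPD d) : (invSqrtm P * X.1 * invSqrtm P).PosDef := by
  have := congr_posDef (isUnit_invSqrtm P) X.2
  rwa [invSqrtm_transpose] at this

theorem logCoord_eq (P X : SPD d) :
    logCoord P X = vect (logm (invSqrtm P * X.1 * invSqrtm P)) := by
  rw [logCoord, tangentCoord, riemLog]
  congr 1
  set L := logm (invSqrtm P * X.1 * invSqrtm P)
  rw [show invSqrtm P * (sqrtm P * L * sqrtm P) * invSqrtm P =
    (invSqrtm P * sqrtm P) * L * (sqrtm P * invSqrtm P) by simp only [Matrix.mul_assoc],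
    invSqrtm_mul_sqrtm, sqrtm_mul_invSqrtm, Matrix.one_mul, Matrix.mul_one]

theorem norm_logCoord (P X : SPD d) : ‖logCoord P X‖ = airmDist P X := by
  rw [logCoord_eq, norm_vect (logm_isHermitian _), airmDist, frobNorm_eq_norm]

theorem airmDist_nonneg (P X : SPD d) : 0 ≤ airmDist P X := by
  rw [← norm_logCoord]; exact norm_nonneg _

theorem expCoord_val (P : SPD d) (t : Coord d) :
    (expCoord P t).1 = sqrtm P * NormedSpace.exp (unvect t) * (sqrtm P)ᵀ := by
  rw [sqrtm_transpose]
  change sqrtm P * NormedSpace.exp (invSqrtm P * (sqrtm P * unvect t * sqrtm P) * invSqrtm P) *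
    sqrtm P = _
  rw [show invSqrtm P * (sqrtm P * unvect t * sqrtm P) * invSqrtm P =
    (invSqrtm P * sqrtm P) * unvect t * (sqrtm P * invSqrtm P) by simp only [Matrix.mul_assoc],
    invSqrtm_mul_sqrtm, sqrtm_mul_invSqrtm, Matrix.one_mul, Matrix.mul_one]

theorem sqrtm_mul_transpose (P : SPD d) : P.1 = sqrtm P * (sqrtm P)ᵀ := by
  rw [sqrtm_transpose, sqrtm_mul_sqrtm]

/-- The logarithm at `P = G Gᵀ` of `X = G (exp C) Gᵀ`. -/
theorem logCoord_of_frame {P X : SPD d} {G C : Matrix (Fin d) (Fin d) ℝ} (hP : P.1 = G * Gᵀ)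
    (hX : X.1 = G * NormedSpace.exp C * Gᵀ) (hC : C.IsHermitian) :
    logCoord P X = vect ((invSqrtm P * G) * C * (invSqrtm P * G)ᵀ) := by
  have hV := invSqrtm_mul_orthogonal hP
  set V := invSqrtm P * G with hVdef
  have hVu : IsUnit V := IsUnit.of_mul_eq_one _ hV
  have hVi : V⁻¹ = Vᵀ := Matrix.inv_eq_right_inv hV
  have h1 : invSqrtm P * X.1 * invSqrtm P = NormedSpace.exp (V * C * Vᵀ) := by
    rw [← hVi, Matrix.exp_conj V C hVu, hVi, hX, hVdef, Matrix.transpose_mul, invSqrtm_transpose]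
    simp only [Matrix.mul_assoc]
  have h2 : (V * C * Vᵀ).IsHermitian := by
    have := Matrix.isHermitian_mul_mul_conjTranspose V hC
    rwa [Matrix.conjTranspose_eq_transpose_of_trivial] at this
  rw [logCoord_eq, h1, logm_exp h2]

theorem logCoord_expCoord (P : SPD d) (t : Coord d) : logCoord P (expCoord P t) = t := by
  rw [logCoord_of_frame (sqrtm_mul_transpose P) (expCoord_val P t) (unvect_isHermitian t),
    invSqrtm_mul_sqrtm]
  simp [vect_unvect]

theorem expCoord_logCoord (P X : SPD d) : expCoord P (logCoord P X) = X := by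
  ext1
  rw [expCoord_val, logCoord_eq, unvect_vect (logm_isHermitian _), exp_logm (whitened_posDef P X),
    sqrtm_transpose, show sqrtm P * (invSqrtm P * X.1 * invSqrtm P) * sqrtm P =
    (sqrtm P * invSqrtm P) * X.1 * (invSqrtm P * sqrtm P) by simp only [Matrix.mul_assoc],
    invSqrtm_mul_sqrtm, sqrtm_mul_invSqrtm, Matrix.one_mul, Matrix.mul_one]

/-- Along the geodesic with initial velocity `v` at `P`, logarithms are multiples of a vector of
the same length as `v`. -/
theorem exists_logCoord_geodesic (P : SPD d) (v : Coord d) (s : ℝ) :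
    ∃ w : Coord d, ‖w‖ = ‖v‖ ∧
      ∀ t : ℝ, logCoord (expCoord P (s • v)) (expCoord P (t • v)) = (t - s) • w := by
  set C := unvect v with hCdef
  have hC : C.IsHermitian := unvect_isHermitian v
  -- P^{1/2} F is a frame at time s, in which the geodesic based there is again the exponential of
  -- multiples of C.
  set F := NormedSpace.exp ((2⁻¹ * s) • C) with hF
  have hFt : Fᵀ = F := exp_smul_transpose hC _
  have hu : ∀ t : ℝ, unvect (t • v) = t • C := fun t => unvectL.map_smul t v
  have hval : ∀ t : ℝ, (expCoord P (t • v)).1 =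
      (sqrtm P * F) * NormedSpace.exp ((t - s) • C) * (sqrtm P * F)ᵀ := by
    intro t
    rw [expCoord_val, hu, Matrix.transpose_mul, hFt,
      show sqrtm P * F * NormedSpace.exp ((t - s) • C) * (F * (sqrtm P)ᵀ) =
        sqrtm P * (F * NormedSpace.exp ((t - s) • C) * F) * (sqrtm P)ᵀ by
        simp only [Matrix.mul_assoc], hF, exp_add_smul, exp_add_smul]
    congr 4
    ring
  have hs := hval s
  rw [sub_self, zero_smul, NormedSpace.exp_zero, Matrix.mul_one] at hs
  have hV := invSqrtm_mul_orthogonal hs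
  set V := invSqrtm (expCoord P (s • v)) * (sqrtm P * F)
  have h2 : (V * C * Vᵀ).IsHermitian := by
    have := Matrix.isHermitian_mul_mul_conjTranspose V hC
    rwa [Matrix.conjTranspose_eq_transpose_of_trivial] at this
  refine ⟨vect (V * C * Vᵀ), ?_, fun t => ?_⟩
  · rw [norm_vect h2, norm_orthogonal_conj (mul_eq_one_comm.1 hV), hCdef, norm_unvect]
  · rw [logCoord_of_frame hs (hval t) (smul_isHermitian _ hC), ← vectL_apply, ← vectL_apply,
      ← map_smul, Matrix.mul_smul, Matrix.smul_mul]

theorem airmDist_geodesic (P : SPD d) (v : Coord d) (s t : ℝ) :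
    airmDist (expCoord P (s • v)) (expCoord P (t • v)) = |t - s| * ‖v‖ := by
  obtain ⟨w, hw, h⟩ := exists_logCoord_geodesic P v s
  rw [← norm_logCoord, h, norm_smul, hw, Real.norm_eq_abs]

theorem expCoord_zero (P : SPD d) : expCoord P 0 = P := by
  ext1
  rw [expCoord_val, show unvect (0 : Coord d) = 0 from unvectL.map_zero, NormedSpace.exp_zero,
    Matrix.mul_one, ← sqrtm_mul_transpose]

theorem airmDist_expCoord (P : SPD d) (v : Coord d) : airmDist P (expCoord P v) = ‖v‖ := by
  rw [← norm_logCoord, logCoord_expCoord]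

/-- Both distances are read on the geodesic joining the two points, between times 0 and 1, where
only |t - s| enters. -/
theorem airmDist_comm (P X : SPD d) : airmDist P X = airmDist X P := by
  have h1 := airmDist_geodesic P (logCoord P X) 0 1
  have h2 := airmDist_geodesic P (logCoord P X) 1 0
  rw [zero_smul, one_smul, expCoord_zero, expCoord_logCoord] at h1 h2
  rw [h1, h2, abs_sub_comm]

/-- The logarithm at any base point is nonexpansive. -/
theorem norm_logCoord_sub_le (R P Q : SPD d) :
    ‖logCoord R P - logCoord R Q‖ ≤ airmDist P Q := by
  set C := logm (invSqrtm P * Q.1 * invSqrtm P) with hCdef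
  have hC : C.IsHermitian := logm_isHermitian _
  have hQ : Q.1 = sqrtm P * NormedSpace.exp C * (sqrtm P)ᵀ := by
    have := expCoord_val P (logCoord P Q)
    rwa [expCoord_logCoord, logCoord_eq, unvect_vect hC] at this
  -- In this frame the points P and Q, whitened at R, become G Gᵀ and G exp(C) Gᵀ, with ‖C‖ equal to
  -- the distance between P and Q.
  have h := norm_vect_logm_sub_le (G := invSqrtm R * sqrtm P)
    ((isUnit_invSqrtm R).mul (sqrtm_isUnit P)) hC
  have e1 : invSqrtm R * Q.1 * invSqrtm R =
      invSqrtm R * sqrtm P * NormedSpace.exp C * (invSqrtm R * sqrtm P)ᵀ := by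
    rw [hQ, Matrix.transpose_mul, invSqrtm_transpose]
    simp only [Matrix.mul_assoc]
  have e2 : invSqrtm R * P.1 * invSqrtm R =
      invSqrtm R * sqrtm P * (invSqrtm R * sqrtm P)ᵀ := by
    rw [sqrtm_mul_transpose P, Matrix.transpose_mul, invSqrtm_transpose]
    simp only [Matrix.mul_assoc]
  rwa [norm_sub_rev, logCoord_eq R, logCoord_eq R, airmDist, frobNorm_eq_norm, e1, e2]

theorem airmDist_self (P : SPD d) : airmDist P P = 0 := by
  have := airmDist_expCoord P 0
  rwa [expCoord_zero, norm_zero] at this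

/-- In the tangent space at P, distances from P are exact and the remaining side is only shortened,
so the Euclidean triangle inequality suffices. -/
theorem airmDist_triangle (P Q R : SPD d) : airmDist P R ≤ airmDist P Q + airmDist Q R := by
  have h := norm_logCoord_sub_le P R Q
  have h' := norm_le_norm_add_norm_sub' (logCoord P R) (logCoord P Q)
  rw [norm_logCoord, norm_logCoord] at h'
  rw [airmDist_comm Q R]
  linarith

theorem eq_of_airmDist_eq_zero {P Q : SPD d} (h : airmDist P Q = 0) : P = Q := by
  rw [← norm_logCoord, norm_eq_zero] at h
  rw [← expCoord_logCoord P Q, h, expCoord_zero]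

/-- The semi-parallelogram law. -/
theorem exists_midpoint (P Q : SPD d) : ∃ M : SPD d, ∀ Z : SPD d,
    airmDist Z M ^ 2 ≤
      2⁻¹ * airmDist Z P ^ 2 + 2⁻¹ * airmDist Z Q ^ 2 - 4⁻¹ * airmDist P Q ^ 2 := by
  -- Seen from the geodesic midpoint, P and Q have opposite logarithms ∓w/2, so the parallelogram
  -- law applies in that tangent space; contraction then gives the inequality.
  obtain ⟨w, hw, h⟩ := exists_logCoord_geodesic P (logCoord P Q) 2⁻¹
  have h0 := h 0
  have h1 := h 1
  rw [zero_smul, expCoord_zero] at h0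
  rw [one_smul, expCoord_logCoord] at h1
  set M := expCoord P ((2⁻¹ : ℝ) • logCoord P Q)
  refine ⟨M, fun Z => ?_⟩
  have hP := norm_logCoord_sub_le M Z P
  have hQ := norm_logCoord_sub_le M Z Q
  rw [h0, show logCoord M Z - (0 - (2⁻¹ : ℝ)) • w = logCoord M Z + (2⁻¹ : ℝ) • w by module] at hP
  rw [h1, show logCoord M Z - (1 - (2⁻¹ : ℝ)) • w = logCoord M Z - (2⁻¹ : ℝ) • w by module] at hQ
  have hpar := parallelogram_law_with_norm ℝ (logCoord M Z) ((2⁻¹ : ℝ) • w)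
  rw [norm_smul, hw, norm_logCoord, norm_logCoord, airmDist_comm M Z] at hpar
  norm_num at hpar
  have hP2 := pow_le_pow_left₀ (norm_nonneg _) hP 2
  have hQ2 := pow_le_pow_left₀ (norm_nonneg _) hQ 2
  nlinarith

/-- The law of cosines in nonpositive curvature. -/
theorem airmDist_sq_ge (P Q Z : SPD d) :
    airmDist Z P ^ 2 + airmDist P Q ^ 2 - 2 * inner ℝ (logCoord P Z) (logCoord P Q) ≤
      airmDist Z Q ^ 2 := by
  have h := pow_le_pow_left₀ (norm_nonneg _) (norm_logCoord_sub_le P Z Q) 2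
  rw [norm_sub_sq_real, norm_logCoord, norm_logCoord, airmDist_comm P Z] at h
  linarith

/-! ### Continuity of logarithm, exponential and distance -/

theorem continuous_logm : Continuous fun P : SPD d => logm P.1 := by
  have h : (fun P : SPD d => logm P.1) = fun P => unvectL (logL (vectL P.1)) := by
    funext P
    rw [vectL_apply, logL_vect P.2.isHermitian, unvectL_apply, unvect_vect (logm_isHermitian _)]
  rw [h]
  refine unvectL.continuous.comp (continuous_iff_continuousAt.2 fun P => ?_)
  have h1 := continuousAt_logL (vect (logm P.1))
  rw [expL_vect_logm P.2] at h1
  exact ContinuousAt.comp (f := fun P : SPD d => vectL P.1) h1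
    (vectL.continuous.comp continuous_subtype_val).continuousAt

theorem continuous_matrixExp :
    Continuous (NormedSpace.exp : Matrix (Fin d) (Fin d) ℝ → Matrix (Fin d) (Fin d) ℝ) :=
  (contDiff_matrixExp (n := 1)).continuous

theorem continuous_invSqrtm : Continuous fun P : SPD d => invSqrtm P := by
  simp_rw [invSqrtm_eq]
  exact continuous_matrixExp.comp ((continuous_const_smul _).comp continuous_logm)

theorem continuous_logCoord : Continuous fun p : SPD d × SPD d => logCoord p.1 p.2 := by
  have h1 : Continuous fun p : SPD d × SPD d =>
      (⟨invSqrtm p.1 * p.2.1 * invSqrtm p.1, whitened_posDef p.1 p.2⟩ : SPD d) := by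
    refine Continuous.subtype_mk ?_ _
    exact ((continuous_invSqrtm.comp continuous_fst).mul
      (continuous_subtype_val.comp continuous_snd)).mul (continuous_invSqrtm.comp continuous_fst)
  simp_rw [logCoord_eq]
  exact vectL.continuous.comp (continuous_logm.comp h1)

theorem continuous_expCoord (P : SPD d) : Continuous (expCoord P) := by
  refine continuous_induced_rng.2 ?_
  have : (Subtype.val ∘ expCoord P) =
      fun t => sqrtm P * NormedSpace.exp (unvectL t) * (sqrtm P)ᵀ := funext (expCoord_val P)
  rw [this]
  exact (continuous_const.mul (continuous_matrixExp.comp unvectL.continuous)).mul continuous_const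

theorem continuous_logCoord_right (P : SPD d) : Continuous fun X => logCoord P X :=
  Continuous.comp (g := fun p : SPD d × SPD d => logCoord p.1 p.2) continuous_logCoord
    (f := fun X => (P, X)) (continuous_const.prodMk continuous_id)

theorem continuous_airmDist : Continuous fun p : SPD d × SPD d => airmDist p.1 p.2 := by
  simp_rw [← norm_logCoord]
  exact continuous_logCoord.norm

/-- Links the metric δ to the matrix topology carried by `SPD`: a small distance means small normal
coordinates, and the exponential map is continuous. -/
theorem tendsto_of_airmDist_tendsto_zero {ι : Type*} {l : Filter ι} {P : ι → SPD d} {Q : SPD d}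
    (h : Tendsto (fun i => airmDist Q (P i)) l (𝓝 0)) : Tendsto P l (𝓝 Q) := by
  simp_rw [← norm_logCoord] at h
  have h1 : Tendsto (fun i => expCoord Q (logCoord Q (P i))) l (𝓝 (expCoord Q 0)) :=
    ((continuous_expCoord Q).tendsto 0).comp (tendsto_zero_iff_norm_tendsto_zero.2 h)
  simpa only [expCoord_logCoord, expCoord_zero] using h1

/-! ### First variation of squared distance and the Jacobian -/

theorem differentiableAt_airmDist_sq_geodesic (P Z : SPD d) (v : Coord d) (t : ℝ) :
    DifferentiableAt ℝ (fun s : ℝ => airmDist Z (expCoord P (s • v)) ^ 2) t := by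
  have hd : HasDerivAt (fun s : ℝ => invSqrtm Z * (expCoord P (s • v)).1 * invSqrtm Z)
      (invSqrtm Z * (sqrtm P * (NormedSpace.exp (t • unvect v) * unvect v) * (sqrtm P)ᵀ) *
        invSqrtm Z) t := by
    have h1 := (((hasDerivAt_exp_smul_const (𝕂 := ℝ) (unvect v) t).const_mul (sqrtm P)).mul_const
      (sqrtm P)ᵀ).const_mul (invSqrtm Z) |>.mul_const (invSqrtm Z)
    have h2 : ∀ s : ℝ, unvect (s • v) = s • unvect v := fun s => unvectL.map_smul s v
    simp_rw [expCoord_val, h2]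
    exact h1
  obtain ⟨l, hl, -⟩ := exists_hasDerivAt_vect_logm hd fun s => whitened_posDef Z _
  have h3 : (fun s : ℝ => airmDist Z (expCoord P (s • v)) ^ 2) = fun s : ℝ =>
      ‖vect (logm (invSqrtm Z * (expCoord P (s • v)).1 * invSqrtm Z))‖ ^ 2 := by
    funext s
    rw [← logCoord_eq, norm_logCoord]
  rw [h3]
  exact hl.norm_sq.differentiableAt

/-- The first variation of the squared distance. -/
theorem hasDerivAt_airmDist_sq_geodesic (P Z : SPD d) (v : Coord d) :
    HasDerivAt (fun s : ℝ => airmDist Z (expCoord P (s • v)) ^ 2)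
      (-2 * inner ℝ (logCoord P Z) v) 0 := by
  have h1 := (differentiableAt_airmDist_sq_geodesic P Z v 0).hasDerivAt
  have h2 := h1.add ((hasDerivAt_id (0 : ℝ)).mul_const (2 * inner ℝ (logCoord P Z) v))
  -- By the law of cosines the sum is at least its value at 0 plus s²‖v‖². Differentiability being
  -- known, this one-sided bound already determines the derivative.
  have hmin : IsLocalMin ((fun s : ℝ => airmDist Z (expCoord P (s • v)) ^ 2) +
      fun s => id s * (2 * inner ℝ (logCoord P Z) v)) 0 := by
    refine Eventually.of_forall fun t => ?_
    have h := airmDist_sq_ge P (expCoord P (t • v)) Z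
    rw [logCoord_expCoord, inner_smul_right] at h
    simp only [Pi.add_apply, zero_smul, expCoord_zero, id]
    nlinarith [sq_nonneg (airmDist P (expCoord P (t • v)))]
  have h3 := hmin.hasDerivAt_eq_zero h2
  have h4 : deriv (fun s : ℝ => airmDist Z (expCoord P (s • v)) ^ 2) 0 =
      -2 * inner ℝ (logCoord P Z) v := by linarith
  rwa [h4] at h1

/-- The differential is that of the matrix exponential followed by congruence with the invertible
Q^{-1/2}P^{1/2}; both are injective. Only nonvanishing is needed, the Jacobian being the same for
all classes. -/
theorem expJacobian_ne_zero (P : SPD d) (t : Coord d) : expJacobian P t ≠ 0 := by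
  set Q := expCoord P t
  set G := invSqrtm Q * sqrtm P with hG
  have hGu : IsUnit G := (isUnit_invSqrtm Q).mul (sqrtm_isUnit P)
  let B : Coord d →L[ℝ] Coord d := LinearMap.toContinuousLinearMap
    { toFun := fun s => vectL (G * unvectL s * Gᵀ)
      map_add' := fun a b => by rw [map_add, Matrix.mul_add, Matrix.add_mul, map_add]
      map_smul' := fun c a => by
        rw [map_smul, Matrix.mul_smul, Matrix.smul_mul, map_smul, RingHom.id_apply] }
  have hB : ∀ s, B s = vect (G * unvect s * Gᵀ) := fun s => rfl
  have hBinj : Function.Injective B := by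
    intro a b hab
    rw [hB, hB] at hab
    have hH : ∀ s : Coord d, (G * unvect s * Gᵀ).IsHermitian := fun s => by
      have := Matrix.isHermitian_mul_mul_conjTranspose G (unvect_isHermitian s)
      rwa [Matrix.conjTranspose_eq_transpose_of_trivial] at this
    have h1 := vect_injOn (hH a) (hH b) hab
    have hGt : IsUnit Gᵀ := (Matrix.isUnit_transpose G).2 hGu
    have h2 := hGu.mul_left_cancel (hGt.mul_right_cancel h1)
    rw [← vect_unvect a, h2, vect_unvect]
  have hfun : (fun s : Coord d => tangentCoord Q (expCoord P s).1) = fun s => B (expL s) := by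
    funext s
    rw [hB, unvect_expL, tangentCoord, expCoord_val, hG, Matrix.transpose_mul, invSqrtm_transpose]
    simp only [Matrix.mul_assoc]
  have hd : HasFDerivAt (fun s : Coord d => B (expL s)) (B.comp (fderiv ℝ expL t)) t :=
    B.hasFDerivAt.comp t (hasFDerivAt_expL t)
  rw [expJacobian, hfun, hd.fderiv, ContinuousLinearMap.det]
  have hinj : Function.Injective (B.comp (fderiv ℝ expL t)) :=
    hBinj.comp (fderiv_expL_injective t)
  exact (LinearEquiv.isUnit_det' (LinearEquiv.ofInjectiveEndo
    ((B.comp (fderiv ℝ expL t) : Coord d →L[ℝ] Coord d) : Coord d →ₗ[ℝ] Coord d) hinj)).ne_zero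

end Frobenius

/-! ### Fréchet means -/

section Means

theorem measurable_airmDist (Q : SPD d) : Measurable fun X : SPD d => airmDist X Q := by
  have h : Continuous fun X : SPD d => airmDist X Q :=
    Continuous.comp (g := fun p : SPD d × SPD d => airmDist p.1 p.2) continuous_airmDist
      (f := fun X => (X, Q)) (continuous_id.prodMk continuous_const)
  exact h.measurable

theorem measurable_logCoord (P : SPD d) : Measurable fun X : SPD d => logCoord P X :=
  (continuous_logCoord_right P).measurable

theorem airmDist_sq_le (X P Q : SPD d) :
    airmDist X P ^ 2 ≤ 2 * airmDist X Q ^ 2 + 2 * airmDist Q P ^ 2 := by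
  have h := airmDist_triangle X Q P
  nlinarith [airmDist_nonneg X P, airmDist_nonneg X Q, airmDist_nonneg Q P,
    sq_nonneg (airmDist X Q - airmDist Q P)]

theorem abs_airmDist_sq_sub_le (X P Q : SPD d) :
    |airmDist X P ^ 2 - airmDist X Q ^ 2| ≤ airmDist P Q * (airmDist X P + airmDist X Q) := by
  have h1 := airmDist_triangle X Q P
  have h2 := airmDist_triangle X P Q
  rw [airmDist_comm Q P] at h1
  have h3 : |airmDist X P - airmDist X Q| ≤ airmDist P Q := abs_le.2 ⟨by linarith, by linarith⟩
  rw [sq_sub_sq, abs_mul, abs_of_nonneg (add_nonneg (airmDist_nonneg X P) (airmDist_nonneg X Q)),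
    mul_comm]
  exact mul_le_mul_of_nonneg_right h3 (add_nonneg (airmDist_nonneg X P) (airmDist_nonneg X Q))

variable {ν : Measure (SPD d)} [IsFiniteMeasure ν]

theorem HasFiniteSecondMoment.integrable_sq (h : HasFiniteSecondMoment ν) (P : SPD d) :
    Integrable (fun X => airmDist X P ^ 2) ν := by
  obtain ⟨Q, hQ⟩ := h
  refine ((hQ.const_mul 2).add (integrable_const (2 * airmDist Q P ^ 2))).mono'
    ((measurable_airmDist P).pow_const 2).aestronglyMeasurable (Eventually.of_forall fun X => ?_)
  rw [Real.norm_of_nonneg (sq_nonneg _)]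
  exact airmDist_sq_le X P Q

theorem HasFiniteSecondMoment.integrable_airmDist (h : HasFiniteSecondMoment ν) (P : SPD d) :
    Integrable (fun X => airmDist X P) ν := by
  refine ((integrable_const (1 : ℝ)).add (h.integrable_sq P)).mono'
    (measurable_airmDist P).aestronglyMeasurable (Eventually.of_forall fun X => ?_)
  rw [Real.norm_of_nonneg (airmDist_nonneg _ _)]
  simp only [Pi.add_apply]
  nlinarith [sq_nonneg (airmDist X P - 1)]

theorem HasFiniteSecondMoment.integrable_logCoord (h : HasFiniteSecondMoment ν) (P : SPD d) :
    Integrable (fun X => logCoord P X) ν := by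
  refine (h.integrable_airmDist P).mono' (measurable_logCoord P).aestronglyMeasurable
    (Eventually.of_forall fun X => ?_)
  rw [norm_logCoord, airmDist_comm]

theorem HasFiniteSecondMoment.continuous_integral (h : HasFiniteSecondMoment ν) (P : SPD d) :
    Continuous fun v : Coord d => ∫ X, airmDist X (expCoord P v) ^ 2 ∂ν := by
  refine continuous_iff_continuousAt.2 fun v₀ => ?_
  refine continuousAt_of_dominated
    (bound := fun X => 2 * airmDist X P ^ 2 + 2 * (‖v₀‖ + 1) ^ 2)
    (Eventually.of_forall fun v => ((measurable_airmDist _).pow_const 2).aestronglyMeasurable)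
    ?_ (((h.integrable_sq P).const_mul 2).add (integrable_const _))
    (Eventually.of_forall fun X => ?_)
  · have hv : ∀ᶠ v in 𝓝 v₀, ‖v‖ < ‖v₀‖ + 1 :=
      continuous_norm.continuousAt.eventually_lt continuousAt_const (by linarith)
    filter_upwards [hv] with v hv
    refine Eventually.of_forall fun X => ?_
    rw [Real.norm_of_nonneg (sq_nonneg _)]
    refine (airmDist_sq_le X _ P).trans ?_
    rw [airmDist_expCoord]
    have := pow_le_pow_left₀ (norm_nonneg v) hv.le 2
    linarith
  · refine ContinuousAt.pow ?_ 2
    exact (Continuous.comp (g := fun p : SPD d × SPD d => airmDist p.1 p.2) continuous_airmDist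
      (f := fun v => (X, expCoord P v))
      (continuous_const.prodMk (continuous_expCoord P))).continuousAt

/-- A nonzero finite measure with finite second moment has exactly one Fréchet mean. -/
theorem existsUnique_isFrechetMean (hν : ν ≠ 0) (h : HasFiniteSecondMoment ν) :
    ∃! P, IsFrechetMean ν P := by
  have hpos : 0 < ν.real Set.univ := by
    rw [measureReal_def, ENNReal.toReal_pos_iff]
    exact ⟨Measure.measure_univ_pos.2 hν, measure_lt_top _ _⟩
  obtain ⟨P₀⟩ : Nonempty (SPD d) := inferInstance
  have hco : ∀ᶠ v in cocompact (Coord d), ∫ X, airmDist X (expCoord P₀ 0) ^ 2 ∂ν ≤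
      ∫ X, airmDist X (expCoord P₀ v) ^ 2 ∂ν := by
    have ht : Tendsto (fun v : Coord d => ‖v‖ ^ 2 * ν.real Set.univ) (cocompact _) atTop :=
      ((tendsto_pow_atTop two_ne_zero).comp (tendsto_norm_cocompact_atTop (E := Coord d))
        ).atTop_mul_const hpos
    -- Integrating ‖v‖² ≤ 2δ(X,P₀)² + 2δ(X,Exp v)² bounds the value at v below; the factor 4 makes
    -- that bound at least the value at P₀.
    filter_upwards [ht.eventually_ge_atTop (4 * ∫ X, airmDist X P₀ ^ 2 ∂ν)] with v hv
    rw [expCoord_zero]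
    have h1 : ∫ _, ‖v‖ ^ 2 ∂ν ≤
        ∫ X, (2 * airmDist X P₀ ^ 2 + 2 * airmDist X (expCoord P₀ v) ^ 2) ∂ν := by
      refine integral_mono (integrable_const _)
        (((h.integrable_sq _).const_mul 2).add ((h.integrable_sq _).const_mul 2)) fun X => ?_
      have := airmDist_sq_le P₀ (expCoord P₀ v) X
      rwa [airmDist_expCoord, airmDist_comm P₀ X] at this
    rw [integral_add ((h.integrable_sq _).const_mul 2) ((h.integrable_sq _).const_mul 2),
      integral_const_mul, integral_const_mul, integral_const, smul_eq_mul] at h1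
    nlinarith
  obtain ⟨v, hv⟩ := (h.continuous_integral P₀).exists_forall_le' 0 hco
  refine ⟨expCoord P₀ v, ⟨h.integrable_sq, fun Q => ?_⟩, fun P hP => ?_⟩
  · have := hv (logCoord P₀ Q)
    rwa [expCoord_logCoord] at this
  · set Q := expCoord P₀ v
    have hQ : ∀ R, ∫ X, airmDist X Q ^ 2 ∂ν ≤ ∫ X, airmDist X R ^ 2 ∂ν := fun R => by
      have := hv (logCoord P₀ R)
      rwa [expCoord_logCoord] at this
    -- Two distinct minimisers are impossible: averaging the semi-parallelogram law, their midpoint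
    -- would have a strictly smaller value.
    obtain ⟨M, hM⟩ := exists_midpoint P Q
    have hsum : Integrable (fun X => 2⁻¹ * airmDist X P ^ 2 + 2⁻¹ * airmDist X Q ^ 2) ν :=
      ((h.integrable_sq _).const_mul _).add ((h.integrable_sq _).const_mul _)
    have h1 : ∫ X, airmDist X M ^ 2 ∂ν ≤ ∫ X, (2⁻¹ * airmDist X P ^ 2 + 2⁻¹ * airmDist X Q ^ 2 -
        4⁻¹ * airmDist P Q ^ 2) ∂ν := by
      refine integral_mono (h.integrable_sq M) (hsum.sub (integrable_const _)) hM
    rw [integral_sub hsum (integrable_const _), integral_add ((h.integrable_sq _).const_mul _)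
      ((h.integrable_sq _).const_mul _), integral_const_mul, integral_const_mul, integral_const,
      smul_eq_mul] at h1
    have h2 := hP.2 M
    have h3 := hQ M
    have h4 : airmDist P Q ^ 2 ≤ 0 := by
      by_contra hc
      have := mul_pos hpos (not_le.1 hc)
      nlinarith
    exact eq_of_airmDist_eq_zero (by nlinarith [sq_nonneg (airmDist P Q)])

/-- A sample mean is a Fréchet mean of a sum of Dirac masses. The sum is left unnormalised, which is
why the existence theorem is stated for nonzero finite measures. -/
theorem isRiemannianMean_iff {N : ℕ} (x : Fin N → SPD d) (P : SPD d) :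
    IsRiemannianMean x P ↔ IsFrechetMean (∑ i, Measure.dirac (x i)) P := by
  have hi : ∀ Q, ∀ i ∈ Finset.univ,
      Integrable (fun X => airmDist X Q ^ 2) (Measure.dirac (x i)) := fun Q i _ =>
    integrable_dirac (by simp)
  have hs : ∀ Q, ∫ X, airmDist X Q ^ 2 ∂(∑ i, Measure.dirac (x i)) = ∑ i, airmDist (x i) Q ^ 2 :=
    fun Q => by
      rw [integral_finsetSum_measure (hi Q)]
      refine Finset.sum_congr rfl fun i _ => ?_
      exact integral_dirac' _ _ ((measurable_airmDist Q).pow_const 2).stronglyMeasurable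
  simp only [IsRiemannianMean, IsFrechetMean, hs]
  exact ⟨fun h => ⟨fun Q => integrable_finsetSum_measure.2 (hi Q), h⟩, fun h => h.2⟩

theorem existsUnique_isRiemannianMean {N : ℕ} (hN : 0 < N) (x : Fin N → SPD d) :
    ∃! P, IsRiemannianMean x P := by
  simp_rw [isRiemannianMean_iff]
  refine existsUnique_isFrechetMean (fun h => ?_) ⟨x ⟨0, hN⟩, ?_⟩
  · have := congrArg (fun μ : Measure (SPD d) => μ Set.univ) h
    simp [hN.ne'] at this
  · exact integrable_finsetSum_measure.2 fun i _ => integrable_dirac (by simp)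

theorem isRiemannianMean_riemannianMean {N : ℕ} (hN : 0 < N) (x : Fin N → SPD d) :
    IsRiemannianMean x (riemannianMean x) :=
  Classical.epsilon_spec (existsUnique_isRiemannianMean hN x).exists

/-- The gradient of the Fréchet functional vanishes at a Fréchet mean. -/
theorem IsFrechetMean.integral_logCoord {P : SPD d} (h : IsFrechetMean ν P) :
    ∫ X, logCoord P X ∂ν = 0 := by
  have hm : HasFiniteSecondMoment ν := ⟨P, h.1 P⟩
  have key : ∀ v : Coord d, inner ℝ v (∫ X, logCoord P X ∂ν) = 0 := by
    intro v
    -- For |s| < 1 the geodesic stays within ‖v‖ of P, so the squared distance to X is Lipschitz in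
    -- s with a constant affine in δ(X,P), hence integrable.
    have hd := hasDerivAt_integral_of_dominated_loc_of_lip (μ := ν)
      (F := fun (s : ℝ) X => airmDist X (expCoord P (s • v)) ^ 2)
      (F' := fun X => -2 * inner ℝ (logCoord P X) v) (x₀ := 0)
      (bound := fun X => ‖v‖ * (2 * airmDist X P + 2 * ‖v‖))
      (Metric.ball_mem_nhds (0 : ℝ) one_pos)
      (Eventually.of_forall fun s => ((measurable_airmDist _).pow_const 2).aestronglyMeasurable)
      (hm.integrable_sq _)
      (((measurable_logCoord P).inner_const (c := v)).const_mul (-2)).aestronglyMeasurable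
      (Eventually.of_forall fun X => by
        refine LipschitzOnWith.of_dist_le_mul fun s hs t ht => ?_
        rw [Real.dist_eq, Real.dist_eq]
        refine (abs_airmDist_sq_sub_le X _ _).trans ?_
        rw [airmDist_geodesic, abs_sub_comm t s]
        have hb : ∀ r ∈ Metric.ball (0 : ℝ) 1,
            airmDist X (expCoord P (r • v)) ≤ airmDist X P + ‖v‖ := by
          intro r hr
          refine (airmDist_triangle X P _).trans ?_
          rw [airmDist_expCoord, norm_smul]
          have : ‖r‖ ≤ 1 := by simpa using (Metric.mem_ball.1 hr).le
          nlinarith [norm_nonneg v]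
        have h0 : 0 ≤ ‖v‖ * (2 * airmDist X P + 2 * ‖v‖) := by
          have := airmDist_nonneg X P
          positivity
        rw [Real.coe_nnabs, abs_of_nonneg h0, mul_comm |s - t|, mul_assoc,
          mul_comm (‖v‖ * _), mul_left_comm]
        refine mul_le_mul_of_nonneg_left ?_ (abs_nonneg _)
        exact mul_le_mul_of_nonneg_left (by linarith [hb s hs, hb t ht]) (norm_nonneg v))
      (((((hm.integrable_airmDist P).const_mul 2).add (integrable_const (2 * ‖v‖)))).const_mul ‖v‖)
      (Eventually.of_forall fun X => hasDerivAt_airmDist_sq_geodesic P X v)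
    have hmin : IsLocalMin (fun s : ℝ => ∫ X, airmDist X (expCoord P (s • v)) ^ 2 ∂ν) 0 := by
      refine Eventually.of_forall fun s => ?_
      simp only [zero_smul, expCoord_zero]
      exact h.2 _
    have h0 := hmin.hasDerivAt_eq_zero hd.2
    rw [integral_const_mul] at h0
    simp_rw [real_inner_comm v] at h0
    rw [integral_inner (hm.integrable_logCoord P)] at h0
    linarith
  -- The mean logarithm is orthogonal to every direction, in particular to itself.
  have := key (∫ X, logCoord P X ∂ν)
  exact inner_self_eq_zero.1 this

end Means

/-! ### Laws of large numbers -/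

section LawOfLargeNumbers

variable {K : ℕ} {α : Fin K → Measure (SPD d)}

theorem integrable_labelledDistribution {E : Type*} [NormedAddCommGroup E]
    [MeasurableSpace E] [BorelSpace E]
    [SecondCountableTopology E] {g : SPD d × Fin K → E} (hg : Measurable g)
    (hint : ∀ k, Integrable (fun x => g (x, k)) (α k)) :
    Integrable g (∑ k, (α k).map fun X => (X, k)) := by
  refine integrable_finsetSum_measure.2 fun k _ => ?_
  rw [integrable_map_measure hg.aestronglyMeasurable (by fun_prop)]
  exact hint k

theorem integral_labelledDistribution {E : Type*} [NormedAddCommGroup E]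
    [NormedSpace ℝ E] [MeasurableSpace E] [BorelSpace E] [SecondCountableTopology E]
    {g : SPD d × Fin K → E} (hg : Measurable g)
    (hint : ∀ k, Integrable (fun x => g (x, k)) (α k)) :
    ∫ p, g p ∂(labelledDistribution α) = (K : ℝ)⁻¹ • ∑ k, ∫ x, g (x, k) ∂(α k) := by
  rw [labelledDistribution, integral_smul_measure, integral_finsetSum_measure
    (integrable_finsetSum_measure.1 (integrable_labelledDistribution hg hint))]
  congr 1
  · simp
  · refine Finset.sum_congr rfl fun k _ => ?_
    rw [integral_map (by fun_prop) hg.aestronglyMeasurable]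

variable [∀ k, IsProbabilityMeasure (α k)]
  {E : Type*} [NormedAddCommGroup E] [NormedSpace ℝ E] [CompleteSpace E] [MeasurableSpace E]
  [BorelSpace E] [SecondCountableTopology E]

variable {Ω : Type*} [MeasurableSpace Ω] {Pr : Measure Ω} [IsProbabilityMeasure Pr]
  {X : ℕ → Ω → SPD d} {Y : ℕ → Ω → Fin K}

theorem strong_law_labelled (hX : ∀ i, Measurable (X i)) (hY : ∀ i, Measurable (Y i))
    (hindep : iIndepFun (fun i ω => (X i ω, Y i ω)) Pr)
    (hlaw : ∀ i, Pr.map (fun ω => (X i ω, Y i ω)) = labelledDistribution α)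
    {g : SPD d × Fin K → E} (hg : Measurable g)
    (hint : ∀ k, Integrable (fun x => g (x, k)) (α k)) :
    ∀ᵐ ω ∂Pr, Tendsto (fun N : ℕ => (N : ℝ)⁻¹ • ∑ i ∈ Finset.range N, g (X i ω, Y i ω)) atTop
      (𝓝 ((K : ℝ)⁻¹ • ∑ k, ∫ x, g (x, k) ∂(α k))) := by
  have hXY : ∀ i, Measurable fun ω => (X i ω, Y i ω) := fun i => (hX i).prodMk (hY i)
  -- A label exists at some outcome, so there is a class; hence the weight K⁻¹ in `ℝ≥0∞` is finite.
  have hK : K ≠ 0 := by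
    rintro rfl
    obtain ⟨ω⟩ := Pr.nonempty_of_neZero
    exact (Y 0 ω).elim0
  have hint' : Integrable g (labelledDistribution α) :=
    (integrable_labelledDistribution hg hint).smul_measure (by simp [hK])
  have h0 : Integrable (fun ω => g (X 0 ω, Y 0 ω)) Pr := by
    rw [← hlaw 0] at hint'
    exact hint'.comp_measurable (hXY 0)
  have h := strong_law_ae (μ := Pr) (fun i ω => g (X i ω, Y i ω)) h0
    (fun i j hij => (hindep.comp (fun _ => g) fun _ => hg).indepFun hij)
    (fun i => (IdentDistrib.mk (hXY i).aemeasurable (hXY 0).aemeasurable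
      ((hlaw i).trans (hlaw 0).symm)).comp hg)
  have hE : ∫ ω, g (X 0 ω, Y 0 ω) ∂Pr = (K : ℝ)⁻¹ • ∑ k, ∫ x, g (x, k) ∂(α k) := by
    rw [← integral_labelledDistribution hg hint, ← hlaw 0,
      integral_map (hXY 0).aemeasurable hg.aestronglyMeasurable]
  rwa [hE] at h

theorem strong_law_class (hX : ∀ i, Measurable (X i)) (hY : ∀ i, Measurable (Y i))
    (hindep : iIndepFun (fun i ω => (X i ω, Y i ω)) Pr)
    (hlaw : ∀ i, Pr.map (fun ω => (X i ω, Y i ω)) = labelledDistribution α)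
    {φ : SPD d → ℝ} (hφ : Measurable φ) (k : Fin K) (hint : Integrable φ (α k)) :
    ∀ᵐ ω ∂Pr, Tendsto (fun N : ℕ => (N : ℝ)⁻¹ *
      ∑ i ∈ Finset.range N, if Y i ω = k then φ (X i ω) else 0) atTop
      (𝓝 ((K : ℝ)⁻¹ * ∫ x, φ x ∂(α k))) := by
  have h := strong_law_labelled hX hY hindep hlaw
    (g := fun p => if p.2 = k then φ p.1 else 0)
    (Measurable.ite (measurable_snd (measurableSet_singleton k)) (hφ.comp measurable_fst)
      measurable_const)
    (fun j => by
      by_cases hj : j = k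
      · subst hj; simpa using hint
      · simp [hj])
  have hs : ∑ j, ∫ x, (if j = k then φ x else 0) ∂(α j) = ∫ x, φ x ∂(α k) := by
    rw [Finset.sum_eq_single k]
    · simp
    · intro j _ hj; simp [hj]
    · simp
  simpa only [hs, smul_eq_mul] using h

end LawOfLargeNumbers

/-! ### Averages with a moving base point -/

/-- The squared-distance envelope restricted to the exterior of a ball. -/
def tailEnvelope (P : SPD d) (R : ℕ) (x : SPD d) : ℝ :=
  if (R : ℝ) < airmDist x P then 1 + airmDist x P ^ 2 else 0

theorem tailEnvelope_nonneg (P : SPD d) (R : ℕ) (x : SPD d) : 0 ≤ tailEnvelope P R x := by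
  unfold tailEnvelope
  split_ifs <;> positivity

theorem measurable_tailEnvelope (P : SPD d) (R : ℕ) : Measurable (tailEnvelope P R) :=
  Measurable.ite (measurableSet_lt measurable_const (measurable_airmDist P))
    (measurable_const.add ((measurable_airmDist P).pow_const 2)) measurable_const

theorem tailEnvelope_le (P : SPD d) (R : ℕ) (x : SPD d) :
    ‖tailEnvelope P R x‖ ≤ 1 + airmDist x P ^ 2 := by
  rw [Real.norm_of_nonneg (tailEnvelope_nonneg P R x)]
  unfold tailEnvelope
  split_ifs
  · exact le_rfl
  · positivity

variable {ν : Measure (SPD d)} [IsFiniteMeasure ν]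

theorem HasFiniteSecondMoment.integrable_tailEnvelope (h : HasFiniteSecondMoment ν) (P : SPD d)
    (R : ℕ) : Integrable (tailEnvelope P R) ν :=
  ((integrable_const 1).add (h.integrable_sq P)).mono'
    (measurable_tailEnvelope P R).aestronglyMeasurable
    (Eventually.of_forall (tailEnvelope_le P R))

theorem HasFiniteSecondMoment.tendsto_integral_tailEnvelope (h : HasFiniteSecondMoment ν)
    (P : SPD d) : Tendsto (fun R => ∫ x, tailEnvelope P R x ∂ν) atTop (𝓝 0) := by
  have h1 := tendsto_integral_of_dominated_convergence (μ := ν)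
    (F := fun R x => tailEnvelope P R x) (f := fun _ => (0 : ℝ))
    (fun x => 1 + airmDist x P ^ 2)
    (fun R => (measurable_tailEnvelope P R).aestronglyMeasurable)
    ((integrable_const 1).add (h.integrable_sq P))
    (fun R => Eventually.of_forall (tailEnvelope_le P R))
    (Eventually.of_forall fun x => by
      refine tendsto_const_nhds.congr' ?_
      filter_upwards [tendsto_natCast_atTop_atTop.eventually_ge_atTop (airmDist x P)] with R hR
      simp [tailEnvelope, not_lt.2 hR])
  simpa using h1

/-- Uniform convergence on bounded sets of a continuous function of two points. -/
theorem eventually_forall_abs_sub_lt {g : SPD d → SPD d → ℝ}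
    (hg : Continuous fun p : SPD d × SPD d => g p.1 p.2) (P : SPD d) (R : ℝ) {ε : ℝ}
    (hε : 0 < ε) :
    ∀ᶠ Q in 𝓝 P, ∀ x, airmDist x P ≤ R → |g Q x - g P x| < ε := by
  have hK : IsCompact (expCoord P '' Metric.closedBall 0 R) :=
    (isCompact_closedBall 0 R).image (continuous_expCoord P)
  have h := hK.eventually_forall_of_forall_eventually (x₀ := P)
    (P := fun Q x => |g Q x - g P x| < ε) (fun x _ => by
      have hc : Continuous fun z : SPD d × SPD d => |g z.1 z.2 - g P z.2| :=
        (hg.sub (hg.comp (f := fun z : SPD d × SPD d => (P, z.2))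
          (continuous_const.prodMk continuous_snd))).abs
      exact hc.continuousAt.eventually_lt continuousAt_const (by simpa using hε))
  filter_upwards [h] with Q hQ x hx
  refine hQ x ⟨logCoord P x, ?_, expCoord_logCoord P x⟩
  rw [mem_closedBall_zero_iff, norm_logCoord, airmDist_comm]
  exact hx

/-- If the averages of the squared-distance envelope have uniformly small tails, then averages of
a function of at most quadratic growth depend continuously on the base point. -/
theorem tendsto_average_abs_sub {g : SPD d → SPD d → ℝ}
    (hg : Continuous fun p : SPD d × SPD d => g p.1 p.2)
    (hgrow : ∀ P x, |g P x| ≤ 1 + airmDist x P ^ 2)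
    {P : SPD d} {Q : ℕ → SPD d} (hQ : Tendsto Q atTop (𝓝 P)) {x : ℕ → SPD d} {T : ℕ → ℝ}
    (hT : Tendsto T atTop (𝓝 0))
    (htail : ∀ R : ℕ, Tendsto (fun N : ℕ => (N : ℝ)⁻¹ *
      ∑ i ∈ Finset.range N, tailEnvelope P R (x i)) atTop (𝓝 (T R))) :
    Tendsto (fun N : ℕ => (N : ℝ)⁻¹ * ∑ i ∈ Finset.range N, |g (Q N) (x i) - g P (x i)|) atTop
      (𝓝 0) := by
  have hbound : ∀ N : ℕ, 0 ≤ (N : ℝ)⁻¹ * ∑ i ∈ Finset.range N, |g (Q N) (x i) - g P (x i)| :=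
    fun N => mul_nonneg (by positivity) (Finset.sum_nonneg fun i _ => abs_nonneg _)
  rw [Metric.tendsto_atTop']
  intro ε hε
  -- R is fixed before N. The tail enters with factor 4, so ε/12 leaves ε/3 for the exterior, next
  -- to ε/2 for the ball.
  obtain ⟨R, hR⟩ := (hT.eventually_lt_const (show (0 : ℝ) < ε / 12 by positivity)).exists
  have hd : ∀ᶠ N in atTop, airmDist P (Q N) < 1 := by
    have hc : Continuous fun z : SPD d => airmDist P z :=
      Continuous.comp (g := fun p : SPD d × SPD d => airmDist p.1 p.2) continuous_airmDist
        (f := fun z => (P, z)) (continuous_const.prodMk continuous_id)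
    refine (hc.continuousAt.tendsto.comp hQ).eventually_lt_const ?_
    rw [airmDist_self]; exact one_pos
  have hu := hQ.eventually (eventually_forall_abs_sub_lt hg P R (half_pos hε))
  obtain ⟨N₀, hN₀⟩ := eventually_atTop.1
    ((hd.and hu).and ((htail R).eventually_lt_const hR))
  refine ⟨N₀, fun N hN => ?_⟩
  obtain ⟨⟨hd, hu⟩, ht⟩ := hN₀ N hN.le
  rw [Real.dist_eq, sub_zero, abs_of_nonneg (hbound N)]
  have hNpos : (0 : ℝ) < N := by exact_mod_cast (Nat.zero_le N₀).trans_lt hN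
  -- Outside the ball, growth and δ(P,Q N) ≤ 1 bound the difference by 4 + 3δ(x,P)², whence the
  -- factor 4.
  have hterm : ∀ i ∈ Finset.range N,
      |g (Q N) (x i) - g P (x i)| ≤ ε / 2 + 4 * tailEnvelope P R (x i) := by
    intro i _
    by_cases hi : airmDist (x i) P ≤ R
    · have := hu (x i) hi
      linarith [tailEnvelope_nonneg P R (x i)]
    · have h1 := hgrow (Q N) (x i)
      have h2 := hgrow P (x i)
      have h3 := abs_sub (g (Q N) (x i)) (g P (x i))
      have h4 := airmDist_sq_le (x i) (Q N) P
      have h5 : airmDist P (Q N) ^ 2 ≤ 1 := by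
        have := airmDist_nonneg P (Q N)
        nlinarith
      rw [tailEnvelope, if_pos (not_le.1 hi)]
      nlinarith [sq_nonneg (airmDist (x i) P)]
  calc (N : ℝ)⁻¹ * ∑ i ∈ Finset.range N, |g (Q N) (x i) - g P (x i)|
      ≤ (N : ℝ)⁻¹ * ∑ i ∈ Finset.range N, (ε / 2 + 4 * tailEnvelope P R (x i)) := by
        gcongr with i hi; exact hterm i hi
    _ = ε / 2 + 4 * ((N : ℝ)⁻¹ * ∑ i ∈ Finset.range N, tailEnvelope P R (x i)) := by
        rw [Finset.sum_add_distrib, ← Finset.mul_sum, Finset.sum_const, Finset.card_range,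
          nsmul_eq_mul]
        field_simp
    _ < ε := by linarith

/-- The distance from `P` to the Riemannian mean of a sample is controlled by the mean of the
sample in the tangent space at `P`. -/
theorem airmDist_riemannianMean_le {x : ℕ → SPD d} {N : ℕ} (hN : 0 < N) (P : SPD d) :
    airmDist P (riemannianMean fun i : Fin N => x i) ≤
      2 * ‖(N : ℝ)⁻¹ • ∑ i ∈ Finset.range N, logCoord P (x i)‖ := by
  set Q := riemannianMean fun i : Fin N => x i
  have hmin := isRiemannianMean_riemannianMean hN (fun i : Fin N => x i) P
  rw [← Finset.sum_range (fun i => airmDist (x i) Q ^ 2),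
    ← Finset.sum_range (fun i => airmDist (x i) P ^ 2)] at hmin
  -- Summed law of cosines against minimality of Q: N δ(P,Q)² ≤ 2⟨Σ log x_i, log Q⟩. Cauchy–Schwarz
  -- and division by δ(P,Q) give the bound.
  have hsum := Finset.sum_le_sum fun i (_ : i ∈ Finset.range N) => airmDist_sq_ge P Q (x i)
  rw [Finset.sum_sub_distrib, Finset.sum_add_distrib, Finset.sum_const, Finset.card_range,
    nsmul_eq_mul, ← Finset.mul_sum, ← sum_inner] at hsum
  have hcs := real_inner_le_norm (∑ i ∈ Finset.range N, logCoord P (x i)) (logCoord P Q)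
  rw [norm_logCoord P Q] at hcs
  have hNpos : (0 : ℝ) < N := by exact_mod_cast hN
  rw [norm_smul, norm_inv, Real.norm_natCast]
  rcases (airmDist_nonneg P Q).eq_or_lt with h0 | h0
  · rw [← h0]; positivity
  · have h1 : (N : ℝ) * airmDist P Q ≤ 2 * ‖∑ i ∈ Finset.range N, logCoord P (x i)‖ := by
      refine le_of_mul_le_mul_right ?_ h0
      nlinarith
    rw [← mul_assoc, mul_comm 2, mul_assoc, inv_mul_eq_div, le_div_iff₀ hNpos]
    linarith

/-! ### Discriminant analysis in Euclidean space -/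

/-- The class-independent term `c` cancels in differences. A class with strictly smaller likelihood
is eventually beaten by a better one, and there are finitely many classes; likelihood ties need no
resolution. -/
theorem convergesToBayes_of_tendsto {E : Type*} {K : ℕ} {score : ℕ → Fin K → E → ℝ}
    {f : Fin K → E → ℝ} (hf : ∀ k Z, 0 < f k Z) (c : E → ℝ)
    (h : ∀ Z k, Tendsto (fun N => score N k Z) atTop (𝓝 (Real.log (f k Z) + c Z))) :
    ConvergesToBayes score f := by
  intro Z
  have h1 : ∀ j k, Tendsto (fun N => score N j Z - score N k Z) atTop
      (𝓝 (Real.log (f j Z) - Real.log (f k Z))) := fun j k => by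
    simpa using (h Z j).sub (h Z k)
  refine ⟨h1, ?_⟩
  have h2 : ∀ k, ∀ᶠ N in atTop, k ∈ argmaxClasses (fun k => score N k Z) →
      k ∈ bayesClassifier f Z := by
    intro k
    by_cases hk : k ∈ bayesClassifier f Z
    · exact Eventually.of_forall fun _ _ => hk
    · obtain ⟨j, hj⟩ : ∃ j, f k Z < f j Z := by
        simpa [bayesClassifier, argmaxClasses] using hk
      have hlog : 0 < Real.log (f j Z) - Real.log (f k Z) :=
        sub_pos.2 (Real.log_lt_log (hf k Z) hj)
      filter_upwards [(h1 j k).eventually_const_lt hlog] with N hN hmem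
      have := hmem j
      linarith
  filter_upwards [eventually_all.2 h2] with N hN k hk
  exact hN k hk

section Euclidean

variable {ι : Type*} {K : ℕ}

theorem sum_filter_eq_sum_range {M : Type*} [AddCommMonoid M] (y : ℕ → Fin K) (k : Fin K)
    (N : ℕ) (f : ℕ → M) :
    ∑ i ∈ Finset.univ.filter (fun i : Fin N => y i = k), f i =
      ∑ i ∈ Finset.range N, if y i = k then f i else 0 := by
  rw [Finset.sum_filter, Finset.sum_range]

theorem classCount_eq (y : ℕ → Fin K) (k : Fin K) (N : ℕ) :
    (classCount (fun i : Fin N => y i) k : ℝ) =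
      ∑ i ∈ Finset.range N, if y i = k then 1 else 0 := by
  rw [classCount, ← sum_filter_eq_sum_range y k N (fun _ => (1 : ℝ))]
  simp

theorem classScatter_apply {N : ℕ} (x : Fin N → EuclideanSpace ℝ ι) (y : Fin N → Fin K)
    (k : Fin K) (a b : ι) :
    classScatter x y k a b = ∑ i ∈ Finset.univ.filter (fun i => y i = k), x i a * x i b -
      classCount y k * (classMean x y k a * classMean x y k b) := by
  have hmean : ∀ a, ∑ i ∈ Finset.univ.filter (fun i => y i = k), x i a =
      classCount y k * classMean x y k a := by
    intro a
    -- For an empty class the empirical mean takes the default value 0 and both sides vanish.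
    by_cases h0 : classCount y k = 0
    · have : Finset.univ.filter (fun i => y i = k) = ∅ := Finset.card_eq_zero.1 h0
      simp [this, h0]
    · have : (classCount y k : ℝ) ≠ 0 := by exact_mod_cast h0
      simp [classMean, this]
  have hcard : ∑ _i ∈ Finset.univ.filter (fun i => y i = k), (1 : ℝ) = classCount y k := by
    simp [classCount]
  have e : ∀ i, vecMulVec (x i - classMean x y k).ofLp (x i - classMean x y k).ofLp a b =
      x i a * x i b - x i a * classMean x y k b - classMean x y k a * x i b +
        1 * (classMean x y k a * classMean x y k b) := fun i => by
    simp [vecMulVec_apply]; ring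
  rw [classScatter, Matrix.sum_apply]
  simp_rw [e]
  rw [Finset.sum_add_distrib, Finset.sum_sub_distrib, Finset.sum_sub_distrib, ← Finset.sum_mul,
    ← Finset.mul_sum, ← Finset.sum_mul, hmean, hmean, hcard]
  ring

variable {x : ℕ → ℕ → EuclideanSpace ℝ ι} {y : ℕ → Fin K} {k : Fin K} {p : ℝ}

theorem tendsto_classPrior
    (hp : Tendsto (fun N : ℕ => (N : ℝ)⁻¹ * ∑ i ∈ Finset.range N, if y i = k then (1 : ℝ) else 0)
      atTop (𝓝 p)) :
    Tendsto (fun N : ℕ => classPrior (fun i : Fin N => y i) k) atTop (𝓝 p) := by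
  refine hp.congr fun N => ?_
  rw [classPrior, classCount_eq, inv_mul_eq_div]

/-- The features `x N i` form a doubly indexed array because changing the sample size moves the base
point and hence the coordinates of every earlier observation. -/
theorem tendsto_classMean (hp0 : 0 < p)
    (hp : Tendsto (fun N : ℕ => (N : ℝ)⁻¹ * ∑ i ∈ Finset.range N, if y i = k then (1 : ℝ) else 0)
      atTop (𝓝 p)) {m : EuclideanSpace ℝ ι}
    (hm : ∀ a, Tendsto (fun N : ℕ => (N : ℝ)⁻¹ *
      ∑ i ∈ Finset.range N, if y i = k then x N i a else 0) atTop (𝓝 (p * m a))) :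
    Tendsto (fun N : ℕ => classMean (fun i : Fin N => x N i) (fun i : Fin N => y i) k) atTop
      (𝓝 m) := by
  have hcoord : Tendsto (fun N : ℕ =>
      (classMean (fun i : Fin N => x N i) (fun i : Fin N => y i) k).ofLp) atTop (𝓝 m.ofLp) := by
    refine tendsto_pi_nhds.2 fun a => ?_
    have h := (hm a).div hp hp0.ne'
    rw [mul_div_cancel_left₀ _ hp0.ne'] at h
    refine h.congr' ?_
    filter_upwards [eventually_gt_atTop 0] with N hN
    have hN' : (N : ℝ) ≠ 0 := by exact_mod_cast hN.ne'
    have e : (classMean (fun i : Fin N => x N i) (fun i : Fin N => y i) k).ofLp a =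
        (classCount (fun i : Fin N => y i) k : ℝ)⁻¹ *
          ∑ i ∈ Finset.univ.filter (fun i : Fin N => y i = k), x N i a := by
      simp [classMean]
    rw [Pi.div_apply, e, classCount_eq, sum_filter_eq_sum_range y k N (fun i => x N i a),
      mul_div_mul_left _ _ (inv_ne_zero hN'), inv_mul_eq_div]
  exact ((PiLp.continuous_toLp 2 _).tendsto _).comp hcoord

theorem tendsto_average_classScatter (hp0 : 0 < p)
    (hp : Tendsto (fun N : ℕ => (N : ℝ)⁻¹ * ∑ i ∈ Finset.range N, if y i = k then (1 : ℝ) else 0)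
      atTop (𝓝 p)) {m : EuclideanSpace ℝ ι}
    (hm : ∀ a, Tendsto (fun N : ℕ => (N : ℝ)⁻¹ *
      ∑ i ∈ Finset.range N, if y i = k then x N i a else 0) atTop (𝓝 (p * m a)))
    {S : Matrix ι ι ℝ}
    (hs : ∀ a b, Tendsto (fun N : ℕ => (N : ℝ)⁻¹ *
      ∑ i ∈ Finset.range N, if y i = k then x N i a * x N i b else 0) atTop
        (𝓝 (p * (S a b + m a * m b)))) :
    Tendsto (fun N : ℕ => (N : ℝ)⁻¹ •
      classScatter (fun i : Fin N => x N i) (fun i : Fin N => y i) k) atTop (𝓝 (p • S)) := by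
  refine tendsto_pi_nhds.2 fun a => tendsto_pi_nhds.2 fun b => ?_
  have hmean := tendsto_classMean hp0 hp hm
  have hc : ∀ a, Tendsto (fun N : ℕ =>
      classMean (fun i : Fin N => x N i) (fun i : Fin N => y i) k a) atTop (𝓝 (m a)) := fun a =>
    ((EuclideanSpace.proj (𝕜 := ℝ) a).continuous.tendsto m).comp hmean
  have h := (hs a b).sub (hp.mul ((hc a).mul (hc b)))
  rw [show p * (S a b + m a * m b) - p * (m a * m b) = (p • S) a b by
    rw [Matrix.smul_apply, smul_eq_mul]; ring] at h
  refine h.congr fun N => ?_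
  rw [Matrix.smul_apply, smul_eq_mul, classScatter_apply, classCount_eq,
    sum_filter_eq_sum_range y k N (fun i => x N i a * x N i b)]
  ring

theorem tendsto_classCov (hp0 : 0 < p)
    (hp : Tendsto (fun N : ℕ => (N : ℝ)⁻¹ * ∑ i ∈ Finset.range N, if y i = k then (1 : ℝ) else 0)
      atTop (𝓝 p)) {S : Matrix ι ι ℝ}
    (h : Tendsto (fun N : ℕ => (N : ℝ)⁻¹ •
      classScatter (fun i : Fin N => x N i) (fun i : Fin N => y i) k) atTop (𝓝 (p • S))) :
    Tendsto (fun N : ℕ => classCov (fun i : Fin N => x N i) (fun i : Fin N => y i) k) atTop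
      (𝓝 S) := by
  -- After division by N, the normalisation N_k - 1 becomes N_k/N - 1/N, which still tends to p.
  have h1 := ((hp.sub tendsto_inv_atTop_nhds_zero_nat).inv₀ (by simpa using hp0.ne')).smul h
  rw [sub_zero, smul_smul, inv_mul_cancel₀ hp0.ne', one_smul] at h1
  refine h1.congr' ?_
  filter_upwards [eventually_gt_atTop 0] with N hN
  have hN' : (N : ℝ) ≠ 0 := by exact_mod_cast hN.ne'
  rw [classCov, smul_smul, classCount_eq]
  congr 1
  rw [← mul_inv]
  congr 1
  field_simp

theorem tendsto_pooledCov {S : Fin K → Matrix ι ι ℝ}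
    (h : ∀ k, Tendsto (fun N : ℕ => (N : ℝ)⁻¹ •
      classScatter (fun i : Fin N => x N i) (fun i : Fin N => y i) k) atTop (𝓝 (p • S k))) :
    Tendsto (fun N : ℕ => pooledCov (fun i : Fin N => x N i) (fun i : Fin N => y i)) atTop
      (𝓝 (p • ∑ k, S k)) := by
  have hK : Tendsto (fun N : ℕ => (1 - (K : ℝ) * (N : ℝ)⁻¹)⁻¹) atTop (𝓝 1) := by
    have := ((tendsto_const_nhds (x := (1 : ℝ))).sub
      ((tendsto_inv_atTop_nhds_zero_nat (𝕜 := ℝ)).const_mul (K : ℝ))).inv₀ (by simp)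
    simpa using this
  have h1 := hK.smul (tendsto_finsetSum Finset.univ fun k _ => h k)
  rw [one_smul, ← Finset.smul_sum] at h1
  refine h1.congr' ?_
  filter_upwards [eventually_gt_atTop 0] with N hN
  have hN' : (N : ℝ) ≠ 0 := by exact_mod_cast hN.ne'
  rw [pooledCov, ← Finset.smul_sum, smul_smul]
  congr 1
  rw [← mul_inv]
  congr 1
  field_simp

variable [Fintype ι] [DecidableEq ι]

/-- Written as adjugate over determinant, the inverse is continuous where the determinant is
nonzero; only the limit has to be invertible. -/
theorem tendsto_dotProduct_inv_mulVec {A : ℕ → Matrix ι ι ℝ} {B : Matrix ι ι ℝ}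
    (hA : Tendsto A atTop (𝓝 B)) (hB : B.det ≠ 0) {u v : ℕ → EuclideanSpace ℝ ι}
    {u₀ v₀ : EuclideanSpace ℝ ι} (hu : Tendsto u atTop (𝓝 u₀)) (hv : Tendsto v atTop (𝓝 v₀)) :
    Tendsto (fun N => (u N).ofLp ⬝ᵥ ((A N)⁻¹ *ᵥ (v N).ofLp)) atTop
      (𝓝 (u₀.ofLp ⬝ᵥ (B⁻¹ *ᵥ v₀.ofLp))) := by
  have hinv : Tendsto (fun N => (A N)⁻¹) atTop (𝓝 B⁻¹) := by
    simp_rw [Matrix.inv_def, Ring.inverse_eq_inv']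
    exact (((continuous_id.matrix_det.tendsto B).comp hA).inv₀ hB).smul
      ((continuous_id.matrix_adjugate.tendsto B).comp hA)
  have hu' := ((PiLp.continuous_ofLp 2 fun _ : ι => ℝ).tendsto u₀).comp hu
  have hv' := ((PiLp.continuous_ofLp 2 fun _ : ι => ℝ).tendsto v₀).comp hv
  have hc : Continuous fun q : (ι → ℝ) × Matrix ι ι ℝ × (ι → ℝ) => q.1 ⬝ᵥ (q.2.1 *ᵥ q.2.2) := by
    fun_prop
  exact (hc.tendsto (u₀.ofLp, B⁻¹, v₀.ofLp)).comp
    (hu'.prodMk_nhds (hinv.prodMk_nhds hv'))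

theorem gaussianDensity_pos {S : Matrix ι ι ℝ} (hS : S.PosDef) (m z : EuclideanSpace ℝ ι) :
    0 < gaussianDensity m S z := by
  have := hS.det_pos
  unfold gaussianDensity
  positivity

theorem log_gaussianDensity {S : Matrix ι ι ℝ} (hS : S.PosDef) (m z : EuclideanSpace ℝ ι) :
    Real.log (gaussianDensity m S z) =
      -(1 / 2) * Real.log ((2 * Real.pi) ^ Fintype.card ι) - (1 / 2) * Real.log S.det -
        (1 / 2) * ((z - m).ofLp ⬝ᵥ (S⁻¹ *ᵥ (z - m).ofLp)) := by
  have hdet := hS.det_pos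
  have h1 : 0 < (2 * Real.pi) ^ Fintype.card ι := by positivity
  rw [gaussianDensity, Real.log_mul (by positivity) (Real.exp_pos _).ne', Real.log_exp,
    Real.log_inv, Real.log_sqrt (by positivity), Real.log_mul h1.ne' hdet.ne']
  ring

/-- With a common covariance the term quadratic in z does not depend on the class, which is why a
linear score recovers the Gaussian likelihood ratios. -/
theorem quadratic_expand {S : Matrix ι ι ℝ} (hS : S.PosDef) (m z : EuclideanSpace ℝ ι) :
    (z - m).ofLp ⬝ᵥ (S⁻¹ *ᵥ (z - m).ofLp) = z.ofLp ⬝ᵥ (S⁻¹ *ᵥ z.ofLp) -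
      2 * (z.ofLp ⬝ᵥ (S⁻¹ *ᵥ m.ofLp)) + m.ofLp ⬝ᵥ (S⁻¹ *ᵥ m.ofLp) := by
  have hT : S⁻¹ᵀ = S⁻¹ := by
    have := hS.isHermitian.inv.eq
    rwa [Matrix.conjTranspose_eq_transpose_of_trivial] at this
  have hsymm : m.ofLp ⬝ᵥ (S⁻¹ *ᵥ z.ofLp) = z.ofLp ⬝ᵥ (S⁻¹ *ᵥ m.ofLp) := by
    rw [dotProduct_comm, ← Matrix.vecMul_transpose, hT, Matrix.dotProduct_mulVec]
  rw [WithLp.ofLp_sub, Matrix.mulVec_sub, dotProduct_sub, sub_dotProduct, sub_dotProduct, hsymm]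
  ring

/-- The linear discriminant function converges to the Gaussian log-likelihood, up to a term not
depending on the class. -/
theorem tendsto_ldaScore (hp0 : 0 < p)
    (hp : Tendsto (fun N : ℕ => classPrior (fun i : Fin N => y i) k) atTop (𝓝 p))
    {S : Matrix ι ι ℝ} (hS : S.PosDef) {m z₀ : EuclideanSpace ℝ ι} {z : ℕ → EuclideanSpace ℝ ι}
    (hm : Tendsto (fun N : ℕ => classMean (fun i : Fin N => x N i) (fun i : Fin N => y i) k) atTop
      (𝓝 m))
    (hcov : Tendsto (fun N : ℕ => pooledCov (fun i : Fin N => x N i) (fun i : Fin N => y i)) atTop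
      (𝓝 S)) (hz : Tendsto z atTop (𝓝 z₀)) :
    Tendsto (fun N : ℕ => ldaScore (fun i : Fin N => x N i) (fun i : Fin N => y i) k (z N)) atTop
      (𝓝 (Real.log (gaussianDensity m S z₀) +
        ((1 / 2) * Real.log ((2 * Real.pi) ^ Fintype.card ι) + (1 / 2) * Real.log S.det +
          (1 / 2) * (z₀.ofLp ⬝ᵥ (S⁻¹ *ᵥ z₀.ofLp)) + Real.log p))) := by
  have h1 := tendsto_dotProduct_inv_mulVec hcov hS.det_pos.ne' hz hm
  have h2 := tendsto_dotProduct_inv_mulVec hcov hS.det_pos.ne' hm hm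
  have h := (h1.sub (h2.const_mul (1 / 2))).add (hp.log hp0.ne')
  have e : Real.log (gaussianDensity m S z₀) +
      ((1 / 2) * Real.log ((2 * Real.pi) ^ Fintype.card ι) + (1 / 2) * Real.log S.det +
        (1 / 2) * (z₀.ofLp ⬝ᵥ (S⁻¹ *ᵥ z₀.ofLp)) + Real.log p) =
      z₀.ofLp ⬝ᵥ (S⁻¹ *ᵥ m.ofLp) - (1 / 2) * (m.ofLp ⬝ᵥ (S⁻¹ *ᵥ m.ofLp)) + Real.log p := by
    rw [log_gaussianDensity hS, quadratic_expand hS]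
    ring
  rw [e]
  exact h

/-- The quadratic discriminant function converges to the Gaussian log-likelihood, up to a term not
depending on the class. -/
theorem tendsto_qdaScore (hp0 : 0 < p)
    (hp : Tendsto (fun N : ℕ => classPrior (fun i : Fin N => y i) k) atTop (𝓝 p))
    {S : Matrix ι ι ℝ} (hS : S.PosDef) {m z₀ : EuclideanSpace ℝ ι} {z : ℕ → EuclideanSpace ℝ ι}
    (hm : Tendsto (fun N : ℕ => classMean (fun i : Fin N => x N i) (fun i : Fin N => y i) k) atTop
      (𝓝 m))
    (hcov : Tendsto (fun N : ℕ => classCov (fun i : Fin N => x N i) (fun i : Fin N => y i) k) atTop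
      (𝓝 S)) (hz : Tendsto z atTop (𝓝 z₀)) :
    Tendsto (fun N : ℕ => qdaScore (fun i : Fin N => x N i) (fun i : Fin N => y i) k (z N)) atTop
      (𝓝 (Real.log (gaussianDensity m S z₀) +
        ((1 / 2) * Real.log ((2 * Real.pi) ^ Fintype.card ι) + Real.log p))) := by
  have hzm := hz.sub hm
  have h1 := tendsto_dotProduct_inv_mulVec hcov hS.det_pos.ne' hzm hzm
  have hdet : Tendsto (fun N : ℕ =>
      Real.log (classCov (fun i : Fin N => x N i) (fun i : Fin N => y i) k).det) atTop
      (𝓝 (Real.log S.det)) :=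
    (((continuous_id.matrix_det.tendsto S).comp hcov).log hS.det_pos.ne')
  have h := ((hdet.const_mul (-(1 / 2))).sub (h1.const_mul (1 / 2))).add (hp.log hp0.ne')
  have e : Real.log (gaussianDensity m S z₀) +
      ((1 / 2) * Real.log ((2 * Real.pi) ^ Fintype.card ι) + Real.log p) =
      -(1 / 2) * Real.log S.det - (1 / 2) * ((z₀ - m).ofLp ⬝ᵥ (S⁻¹ *ᵥ (z₀ - m).ofLp)) +
        Real.log p := by
    rw [log_gaussianDensity hS]
    ring
  rw [e]
  exact h

end Euclidean

/-! ### Tangent space discriminant analysis -/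

section TangentSpace

variable {K : ℕ} {α : Fin K → Measure (SPD d)}

theorem integrable_totalDistribution_iff [NeZero K] {E : Type*} [NormedAddCommGroup E]
    {f : SPD d → E} :
    Integrable f (totalDistribution α) ↔ ∀ k, Integrable f (α k) := by
  rw [totalDistribution, integrable_smul_measure (by simp)
    (ENNReal.inv_ne_top.2 (by exact_mod_cast NeZero.ne K)), integrable_finsetSum_measure]
  simp

/-- Integrability is part of `IsFrechetMean` and passes from the mixture to each component, so the
wrapped Gaussian case needs no separate moment hypothesis. -/
theorem IsFrechetMean.hasFiniteSecondMoment [NeZero K] {P : SPD d}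
    (h : IsFrechetMean (totalDistribution α) P) (k : Fin K) : HasFiniteSecondMoment (α k) :=
  ⟨P, integrable_totalDistribution_iff.1 (h.1 P) k⟩

variable [∀ k, IsProbabilityMeasure (α k)]

instance isFiniteMeasure_totalDistribution [NeZero K] : IsFiniteMeasure (totalDistribution α) := by
  unfold totalDistribution
  exact Measure.smul_finite _ (ENNReal.inv_ne_top.2 (by exact_mod_cast NeZero.ne K))

theorem totalDistribution_ne_zero [NeZero K] : totalDistribution α ≠ 0 := by
  intro h
  have h1 := congrArg (fun μ : Measure (SPD d) => μ Set.univ) h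
  simp [totalDistribution, NeZero.ne K] at h1

theorem hasFiniteSecondMoment_totalDistribution [NeZero K]
    (h : ∀ k, HasFiniteSecondMoment (α k)) : HasFiniteSecondMoment (totalDistribution α) := by
  obtain ⟨Q⟩ : Nonempty (SPD d) := inferInstance
  exact ⟨Q, integrable_totalDistribution_iff.2 fun k => (h k).integrable_sq Q⟩

theorem abs_logCoord_le (P X : SPD d) (a : UpperIdx d) : |logCoord P X a| ≤ airmDist X P := by
  rw [airmDist_comm, ← norm_logCoord]
  exact PiLp.norm_apply_le (logCoord P X) a

theorem measurable_logCoord_apply (P : SPD d) (a : UpperIdx d) :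
    Measurable fun X => logCoord P X a :=
  (EuclideanSpace.proj (𝕜 := ℝ) a).continuous.measurable.comp (measurable_logCoord P)

theorem HasFiniteSecondMoment.memLp_logCoord {ν : Measure (SPD d)} [IsFiniteMeasure ν]
    (h : HasFiniteSecondMoment ν) (P : SPD d) (a : UpperIdx d) :
    MemLp (fun X => logCoord P X a) 2 ν := by
  have hm := (measurable_logCoord_apply P a).aestronglyMeasurable (μ := ν)
  rw [memLp_two_iff_integrable_sq hm]
  refine (h.integrable_sq P).mono' (hm.pow 2) (Eventually.of_forall fun X => ?_)
  rw [Real.norm_of_nonneg (sq_nonneg _), ← sq_abs]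
  exact pow_le_pow_left₀ (abs_nonneg _) (abs_logCoord_le P X a) 2

theorem HasFiniteSecondMoment.logMean_apply {ν : Measure (SPD d)} [IsFiniteMeasure ν]
    (h : HasFiniteSecondMoment ν) (P : SPD d) (a : UpperIdx d) :
    logMean P ν a = ∫ X, logCoord P X a ∂ν :=
  ((EuclideanSpace.proj (𝕜 := ℝ) a).integral_comp_comm (h.integrable_logCoord P)).symm

theorem HasFiniteSecondMoment.logCov_add {ν : Measure (SPD d)} [IsProbabilityMeasure ν]
    (h : HasFiniteSecondMoment ν) (P : SPD d) (a b : UpperIdx d) :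
    logCov P ν a b + logMean P ν a * logMean P ν b = ∫ X, logCoord P X a * logCoord P X b ∂ν := by
  rw [logCov, Matrix.of_apply, covariance_eq_sub (h.memLp_logCoord P a) (h.memLp_logCoord P b),
    h.logMean_apply, h.logMean_apply]
  simp

/-- Restricting to a class only drops terms, so the error from moving the base point is dominated by
the absolute error over the whole sample. -/
theorem tendsto_class_average {g : SPD d → SPD d → ℝ}
    (hg : Continuous fun p : SPD d × SPD d => g p.1 p.2)
    (hgrow : ∀ P x, |g P x| ≤ 1 + airmDist x P ^ 2)
    {P : SPD d} {Q : ℕ → SPD d} (hQ : Tendsto Q atTop (𝓝 P)) {x : ℕ → SPD d} {T : ℕ → ℝ}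
    (hT : Tendsto T atTop (𝓝 0))
    (htail : ∀ R : ℕ, Tendsto (fun N : ℕ => (N : ℝ)⁻¹ *
      ∑ i ∈ Finset.range N, tailEnvelope P R (x i)) atTop (𝓝 (T R)))
    {y : ℕ → Fin K} {k : Fin K} {L : ℝ}
    (hL : Tendsto (fun N : ℕ => (N : ℝ)⁻¹ *
      ∑ i ∈ Finset.range N, if y i = k then g P (x i) else 0) atTop (𝓝 L)) :
    Tendsto (fun N : ℕ => (N : ℝ)⁻¹ *
      ∑ i ∈ Finset.range N, if y i = k then g (Q N) (x i) else 0) atTop (𝓝 L) := by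
  have h0 : Tendsto (fun N : ℕ =>
      (N : ℝ)⁻¹ * (∑ i ∈ Finset.range N, if y i = k then g (Q N) (x i) else 0) -
      (N : ℝ)⁻¹ * (∑ i ∈ Finset.range N, if y i = k then g P (x i) else 0)) atTop (𝓝 0) := by
    refine squeeze_zero_norm (fun N => ?_) (tendsto_average_abs_sub hg hgrow hQ hT htail)
    rw [← mul_sub, ← Finset.sum_sub_distrib, norm_mul, Real.norm_of_nonneg (by positivity)]
    refine mul_le_mul_of_nonneg_left ((norm_sum_le _ _).trans ?_) (by positivity)
    refine Finset.sum_le_sum fun i _ => ?_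
    split_ifs
    · exact le_rfl
    · simp
  simpa using h0.add hL

variable {Ω : Type*} [MeasurableSpace Ω] {Pr : Measure Ω} [IsProbabilityMeasure Pr]
  {X : ℕ → Ω → SPD d} {Y : ℕ → Ω → Fin K}

/-- Strong consistency of the Riemannian mean and of the class moments in the tangent space at
the Riemannian mean. -/
theorem ae_tendsto_moments [NeZero K]
    (hX : ∀ i, Measurable (X i)) (hY : ∀ i, Measurable (Y i))
    (hindep : iIndepFun (fun i ω => (X i ω, Y i ω)) Pr)
    (hlaw : ∀ i, Pr.map (fun ω => (X i ω, Y i ω)) = labelledDistribution α)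
    {P : SPD d} (hP : IsFrechetMean (totalDistribution α) P) :
    ∀ᵐ ω ∂Pr, Tendsto (fun N : ℕ => riemannianMean fun i : Fin N => X i ω) atTop (𝓝 P) ∧
      ∀ k, Tendsto (fun N : ℕ => (N : ℝ)⁻¹ *
          ∑ i ∈ Finset.range N, if Y i ω = k then (1 : ℝ) else 0) atTop (𝓝 (K : ℝ)⁻¹) ∧
        (∀ a, Tendsto (fun N : ℕ => (N : ℝ)⁻¹ * ∑ i ∈ Finset.range N, if Y i ω = k then
          logCoord (riemannianMean fun i : Fin N => X i ω) (X i ω) a else 0) atTop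
          (𝓝 ((K : ℝ)⁻¹ * logMean P (α k) a))) ∧
        ∀ a b, Tendsto (fun N : ℕ => (N : ℝ)⁻¹ * ∑ i ∈ Finset.range N, if Y i ω = k then
          logCoord (riemannianMean fun i : Fin N => X i ω) (X i ω) a *
            logCoord (riemannianMean fun i : Fin N => X i ω) (X i ω) b else 0) atTop
          (𝓝 ((K : ℝ)⁻¹ *
            (logCov P (α k) a b + logMean P (α k) a * logMean P (α k) b))) := by
  have hm := hP.hasFiniteSecondMoment
  have h1 := strong_law_labelled hX hY hindep hlaw (g := fun p => logCoord P p.1)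
    ((measurable_logCoord P).comp measurable_fst) (fun k => (hm k).integrable_logCoord P)
  -- The class means of the logarithm cancel at the Fréchet mean of the mixture; this forces the
  -- sample means to converge to P.
  have hzero : (K : ℝ)⁻¹ • ∑ k, ∫ x, logCoord P x ∂(α k) = 0 := by
    have h := hP.integral_logCoord
    rw [totalDistribution, integral_smul_measure,
      integral_finsetSum_measure fun k _ => (hm k).integrable_logCoord P] at h
    simpa using h
  have h2 := ae_all_iff.2 fun k => strong_law_class hX hY hindep hlaw
    (φ := fun _ => (1 : ℝ)) measurable_const k (integrable_const _)
  have h3 := ae_all_iff.2 fun k => ae_all_iff.2 fun a => strong_law_class hX hY hindep hlaw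
    (measurable_logCoord_apply P a) k (((hm k).memLp_logCoord P a).integrable one_le_two)
  have h4 := ae_all_iff.2 fun k => ae_all_iff.2 fun a => ae_all_iff.2 fun b =>
    strong_law_class hX hY hindep hlaw
      ((measurable_logCoord_apply P a).mul (measurable_logCoord_apply P b)) k
      (((hm k).memLp_logCoord P a).integrable_mul ((hm k).memLp_logCoord P b))
  -- Integer radii suffice, so a single null set serves all tails.
  have h5 := ae_all_iff.2 fun R : ℕ => strong_law_labelled hX hY hindep hlaw
    (g := fun p => tailEnvelope P R p.1)
    ((measurable_tailEnvelope P R).comp measurable_fst)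
    (fun k => (hm k).integrable_tailEnvelope P R)
  have hT : Tendsto (fun R : ℕ => (K : ℝ)⁻¹ • ∑ k, ∫ x, tailEnvelope P R x ∂(α k)) atTop
      (𝓝 0) := by
    have := (tendsto_finsetSum Finset.univ fun k _ =>
      (hm k).tendsto_integral_tailEnvelope P).const_smul (K : ℝ)⁻¹
    simpa using this
  have hcoord : ∀ a, Continuous fun p : SPD d × SPD d => logCoord p.1 p.2 a := fun a =>
    (EuclideanSpace.proj (𝕜 := ℝ) a).continuous.comp continuous_logCoord
  filter_upwards [h1, h2, h3, h4, h5] with ω h1 h2 h3 h4 h5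
  have hQ : Tendsto (fun N : ℕ => riemannianMean fun i : Fin N => X i ω) atTop (𝓝 P) := by
    rw [hzero] at h1
    have h1' := (h1.norm.const_mul 2)
    rw [norm_zero, mul_zero] at h1'
    refine tendsto_of_airmDist_tendsto_zero (squeeze_zero' (Eventually.of_forall fun N =>
      airmDist_nonneg _ _) ?_ h1')
    filter_upwards [eventually_gt_atTop 0] with N hN
    exact airmDist_riemannianMean_le (x := fun i => X i ω) hN P
  simp only [smul_eq_mul] at h5 hT
  refine ⟨hQ, fun k => ⟨by simpa using h2 k, fun a => ?_, fun a b => ?_⟩⟩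
  · rw [(hm k).logMean_apply]
    refine tendsto_class_average (g := fun P x => logCoord P x a) (hcoord a) (fun P x => ?_)
      hQ hT h5 (h3 k a)
    have := abs_logCoord_le P x a
    nlinarith [sq_nonneg (airmDist x P - 1)]
  · rw [(hm k).logCov_add]
    refine tendsto_class_average (g := fun P x => logCoord P x a * logCoord P x b)
      ((hcoord a).mul (hcoord b)) (fun P x => ?_) hQ hT h5 (h4 k a b)
    rw [abs_mul]
    have := mul_le_mul (abs_logCoord_le P x a) (abs_logCoord_le P x b) (abs_nonneg _)
      (airmDist_nonneg x P)
    nlinarith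

theorem wrappedGaussianDensity_pos (P : SPD d) (m : Coord d)
    {S : Matrix (UpperIdx d) (UpperIdx d) ℝ} (hS : S.PosDef) (Z : SPD d) :
    0 < wrappedGaussianDensity P m S Z :=
  div_pos (gaussianDensity_pos hS m _) (abs_pos.2 (expJacobian_ne_zero P _))

theorem log_wrappedGaussianDensity (P : SPD d) (m : Coord d)
    {S : Matrix (UpperIdx d) (UpperIdx d) ℝ} (hS : S.PosDef) (Z : SPD d) :
    Real.log (wrappedGaussianDensity P m S Z) =
      Real.log (gaussianDensity m S (logCoord P Z)) -
        Real.log |expJacobian P (logCoord P Z)| :=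
  Real.log_div (gaussianDensity_pos hS m _).ne' (abs_pos.2 (expJacobian_ne_zero P _)).ne'

theorem tendsto_logCoord_left {Q : ℕ → SPD d} {P : SPD d} (hQ : Tendsto Q atTop (𝓝 P))
    (Z : SPD d) : Tendsto (fun N => logCoord (Q N) Z) atTop (𝓝 (logCoord P Z)) :=
  Tendsto.comp (g := fun p : SPD d × SPD d => logCoord p.1 p.2) (f := fun N => (Q N, Z))
    (continuous_logCoord.tendsto (P, Z)) (hQ.prodMk_nhds tendsto_const_nhds)

theorem ae_tsLda_convergesToBayes [NeZero K]
    (hX : ∀ i, Measurable (X i)) (hY : ∀ i, Measurable (Y i))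
    (hindep : iIndepFun (fun i ω => (X i ω, Y i ω)) Pr)
    (hlaw : ∀ i, Pr.map (fun ω => (X i ω, Y i ω)) = labelledDistribution α)
    {P : SPD d} (hP : IsFrechetMean (totalDistribution α) P) (hS : (pooledLogCov P α).PosDef) :
    ∀ᵐ ω ∂Pr, ConvergesToBayes
      (fun N => tsLdaScore (fun i : Fin N => X i ω) (fun i : Fin N => Y i ω))
      (fun k => wrappedGaussianDensity P (logMean P (α k)) (pooledLogCov P α)) := by
  have hK : (0 : ℝ) < (K : ℝ)⁻¹ := inv_pos.2 (by exact_mod_cast NeZero.pos K)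
  filter_upwards [ae_tendsto_moments hX hY hindep hlaw hP] with ω ⟨hQ, hω⟩
  -- The common term collects the log-Jacobian, the Gaussian normalisation, the quadratic term in z
  -- and the limiting log-prior.
  refine convergesToBayes_of_tendsto (fun k Z => wrappedGaussianDensity_pos P _ hS Z)
    (fun Z => Real.log |expJacobian P (logCoord P Z)| +
      ((1 / 2) * Real.log ((2 * Real.pi) ^ Fintype.card (UpperIdx d)) +
      (1 / 2) * Real.log (pooledLogCov P α).det +
      (1 / 2) * ((logCoord P Z).ofLp ⬝ᵥ ((pooledLogCov P α)⁻¹ *ᵥ (logCoord P Z).ofLp)) +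
      Real.log (K : ℝ)⁻¹)) fun Z k => ?_
  set x : ℕ → ℕ → Coord d := fun N i =>
    logCoord (riemannianMean fun i : Fin N => X i ω) (X i ω)
  have hmean := tendsto_classMean (x := x) hK (hω k).1 (hω k).2.1
  have hcov : Tendsto (fun N : ℕ => pooledCov (fun i : Fin N => x N i) (fun i : Fin N => Y i ω))
      atTop (𝓝 (pooledLogCov P α)) :=
    tendsto_pooledCov (y := fun i => Y i ω) (S := fun k => logCov P (α k)) fun k =>
      tendsto_average_classScatter (x := x) hK (hω k).1 (hω k).2.1 (hω k).2.2
  have h := tendsto_ldaScore hK (tendsto_classPrior (hω k).1) hS hmean hcov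
    (tendsto_logCoord_left hQ Z)
  rw [log_wrappedGaussianDensity P _ hS, ← add_assoc, sub_add_cancel]
  exact h

theorem ae_tsQda_convergesToBayes [NeZero K]
    (hX : ∀ i, Measurable (X i)) (hY : ∀ i, Measurable (Y i))
    (hindep : iIndepFun (fun i ω => (X i ω, Y i ω)) Pr)
    (hlaw : ∀ i, Pr.map (fun ω => (X i ω, Y i ω)) = labelledDistribution α)
    {P : SPD d} (hP : IsFrechetMean (totalDistribution α) P)
    (hS : ∀ k, (logCov P (α k)).PosDef) :
    ∀ᵐ ω ∂Pr, ConvergesToBayes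
      (fun N => tsQdaScore (fun i : Fin N => X i ω) (fun i : Fin N => Y i ω))
      (fun k => wrappedGaussianDensity P (logMean P (α k)) (logCov P (α k))) := by
  have hK : (0 : ℝ) < (K : ℝ)⁻¹ := inv_pos.2 (by exact_mod_cast NeZero.pos K)
  filter_upwards [ae_tendsto_moments hX hY hindep hlaw hP] with ω ⟨hQ, hω⟩
  refine convergesToBayes_of_tendsto (fun k Z => wrappedGaussianDensity_pos P _ (hS k) Z)
    (fun Z => Real.log |expJacobian P (logCoord P Z)| +
      ((1 / 2) * Real.log ((2 * Real.pi) ^ Fintype.card (UpperIdx d)) +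
      Real.log (K : ℝ)⁻¹)) fun Z k => ?_
  set x : ℕ → ℕ → Coord d := fun N i =>
    logCoord (riemannianMean fun i : Fin N => X i ω) (X i ω)
  have hmean := tendsto_classMean (x := x) hK (hω k).1 (hω k).2.1
  have hcov := tendsto_classCov hK (hω k).1
    (tendsto_average_classScatter (x := x) hK (hω k).1 (hω k).2.1 (hω k).2.2)
  have h := tendsto_qdaScore hK (tendsto_classPrior (hω k).1) (hS k) hmean hcov
    (tendsto_logCoord_left hQ Z)
  rw [log_wrappedGaussianDensity P _ (hS k), ← add_assoc, sub_add_cancel]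
  exact h

end TangentSpace

/-! ### Tangent moments of wrapped Gaussians -/

theorem logMean_wrappedGaussian (P : SPD d) (m : Coord d)
    (S : Matrix (UpperIdx d) (UpperIdx d) ℝ) : logMean P (wrappedGaussian P m S) = m := by
  rw [logMean, wrappedGaussian, integral_map (continuous_expCoord P).measurable.aemeasurable
    (measurable_logCoord P).aestronglyMeasurable]
  simp_rw [logCoord_expCoord]
  exact integral_id_multivariateGaussian

theorem logCov_wrappedGaussian (P : SPD d) (m : Coord d)
    {S : Matrix (UpperIdx d) (UpperIdx d) ℝ} (hS : S.PosDef) :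
    logCov P (wrappedGaussian P m S) = S := by
  ext a b
  rw [logCov, Matrix.of_apply, wrappedGaussian,
    covariance_map (measurable_logCoord_apply P a).aestronglyMeasurable
      (measurable_logCoord_apply P b).aestronglyMeasurable
      (continuous_expCoord P).measurable.aemeasurable]
  simp only [Function.comp_def, logCoord_expCoord]
  exact covariance_eval_multivariateGaussian hS.posSemidef a b

end SPDLearning

end

theorem mainTheorem3 {d K : ℕ} {Ω : Type*} [MeasurableSpace Ω] (Pr : Measure Ω)
    [IsProbabilityMeasure Pr] (α : Fin K → Measure (SPDLearning.SPD d))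
    [∀ k, IsProbabilityMeasure (α k)]
    (X : ℕ → Ω → SPDLearning.SPD d) (Y : ℕ → Ω → Fin K)
    (hX : ∀ i, Measurable (X i)) (hY : ∀ i, Measurable (Y i))
    (hindep : iIndepFun (fun i ω => (X i ω, Y i ω)) Pr)
    (hlaw : ∀ i, Pr.map (fun ω => (X i ω, Y i ω)) = SPDLearning.labelledDistribution α) :
    -- every nonempty sample has exactly one Riemannian mean
    (∀ N, 0 < N → ∀ x : Fin N → SPDLearning.SPD d, ∃! P, SPDLearning.IsRiemannianMean x P) ∧
    -- class distributions with finite second moments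
    ((∀ k, SPDLearning.HasFiniteSecondMoment (α k)) →
      ∃ Xbar : SPDLearning.SPD d,
        (∀ P, SPDLearning.IsFrechetMean (SPDLearning.totalDistribution α) P ↔ P = Xbar) ∧
        -- Tangent Space LDA
        ((SPDLearning.pooledLogCov Xbar α).PosDef →
          ∀ᵐ ω ∂Pr, SPDLearning.ConvergesToBayes
            (fun N => SPDLearning.tsLdaScore (fun i : Fin N => X i ω) (fun i : Fin N => Y i ω))
            (fun k => SPDLearning.wrappedGaussianDensity Xbar
              (SPDLearning.logMean Xbar (α k)) (SPDLearning.pooledLogCov Xbar α))) ∧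
        -- Tangent Space QDA
        ((∀ k, (SPDLearning.logCov Xbar (α k)).PosDef) →
          ∀ᵐ ω ∂Pr, SPDLearning.ConvergesToBayes
            (fun N => SPDLearning.tsQdaScore (fun i : Fin N => X i ω) (fun i : Fin N => Y i ω))
            (fun k => SPDLearning.wrappedGaussianDensity Xbar
              (SPDLearning.logMean Xbar (α k)) (SPDLearning.logCov Xbar (α k))))) ∧
    -- wrapped Gaussian classes with a common covariance: Tangent Space LDA
    (∀ (Xbar : SPDLearning.SPD d) (μ : Fin K → SPDLearning.Coord d)
        (S : Matrix (SPDLearning.UpperIdx d) (SPDLearning.UpperIdx d) ℝ), S.PosDef →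
      (∀ k, α k = SPDLearning.wrappedGaussian Xbar (μ k) S) →
      SPDLearning.IsFrechetMean (SPDLearning.totalDistribution α) Xbar →
      ∀ᵐ ω ∂Pr, SPDLearning.ConvergesToBayes
        (fun N => SPDLearning.tsLdaScore (fun i : Fin N => X i ω) (fun i : Fin N => Y i ω))
        (fun k => SPDLearning.wrappedGaussianDensity Xbar (μ k) S)) ∧
    -- wrapped Gaussian classes with individual covariances: Tangent Space QDA
    (∀ (Xbar : SPDLearning.SPD d) (μ : Fin K → SPDLearning.Coord d)
        (S : Fin K → Matrix (SPDLearning.UpperIdx d) (SPDLearning.UpperIdx d) ℝ),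
      (∀ k, (S k).PosDef) →
      (∀ k, α k = SPDLearning.wrappedGaussian Xbar (μ k) (S k)) →
      SPDLearning.IsFrechetMean (SPDLearning.totalDistribution α) Xbar →
      ∀ᵐ ω ∂Pr, SPDLearning.ConvergesToBayes
        (fun N => SPDLearning.tsQdaScore (fun i : Fin N => X i ω) (fun i : Fin N => Y i ω))
        (fun k => SPDLearning.wrappedGaussianDensity Xbar (μ k) (S k))) := by
  have hK : NeZero K := ⟨by
    rintro rfl
    obtain ⟨ω⟩ := Pr.nonempty_of_neZero
    exact (Y 0 ω).elim0⟩
  refine ⟨fun N hN x => SPDLearning.existsUnique_isRiemannianMean hN x, fun hm => ?_,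
    fun Xbar μ S hS hα hF => ?_, fun Xbar μ S hS hα hF => ?_⟩
  · obtain ⟨Xbar, hXbar, huniq⟩ := SPDLearning.existsUnique_isFrechetMean
      (SPDLearning.totalDistribution_ne_zero (α := α))
      (SPDLearning.hasFiniteSecondMoment_totalDistribution hm)
    exact ⟨Xbar, fun P => ⟨huniq P, fun h => h ▸ hXbar⟩,
      SPDLearning.ae_tsLda_convergesToBayes hX hY hindep hlaw hXbar,
      SPDLearning.ae_tsQda_convergesToBayes hX hY hindep hlaw hXbar⟩
  -- All classes have tangent covariance S, so their average is S and the general LDA statement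
  -- applies with the given parameters.
  · have hpool : SPDLearning.pooledLogCov Xbar α = S := by
      have hK0 : (K : ℝ) ≠ 0 := by exact_mod_cast NeZero.ne K
      simp only [SPDLearning.pooledLogCov, hα, SPDLearning.logCov_wrappedGaussian Xbar _ hS]
      rw [Finset.sum_const, Finset.card_univ, Fintype.card_fin, ← Nat.cast_smul_eq_nsmul ℝ,
        smul_smul, inv_mul_cancel₀ hK0, one_smul]
    have hmean : ∀ k, SPDLearning.logMean Xbar (α k) = μ k := fun k => by
      rw [hα k, SPDLearning.logMean_wrappedGaussian]
    have h := SPDLearning.ae_tsLda_convergesToBayes hX hY hindep hlaw hF (hpool.symm ▸ hS)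
    simpa only [hpool, hmean] using h
  · have hcov : ∀ k, SPDLearning.logCov Xbar (α k) = S k := fun k => by
      rw [hα k, SPDLearning.logCov_wrappedGaussian Xbar _ (hS k)]
    have hmean : ∀ k, SPDLearning.logMean Xbar (α k) = μ k := fun k => by
      rw [hα k, SPDLearning.logMean_wrappedGaussian]
    have h := SPDLearning.ae_tsQda_convergesToBayes hX hY hindep hlaw hF
      (fun k => (hcov k).symm ▸ hS k)
    simpa only [hcov, hmean] using h
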